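/- Let $0<H_1\le H_2<1$, $\lambda>0$, $0<\alpha<1$, and let $a,b\in\mathbb R$ be not both zero. Let $B^{H_1},B^{H_2}$ be independent fractional Brownian motions with Hurst indices $H_1,H_2$ (centred Gaussian processes with continuous paths, started at $0$, with $E(B^H_sB^H_t)=\frac12(s^{2H}+t^{2H}-|s-t|^{2H})$). Let $S=S^{\lambda,\alpha}$ be a tempered stable subordinator independent of the pair $(B^{H_1},B^{H_2})$, that is, a non-negative non-decreasing Lévy process such that $S_t$, $t>0$, has on $(0,\infty)$ the density $$f_{\lambda,\alpha}(x,t)=e^{-\lambda x+\lambda^\alpha t}\,\frac1\pi\int_0^\infty e^{-xy}e^{-ty^\alpha\cos\alpha\pi}\sin(ty^\alpha\sin\alpha\pi)\,dy .$$ Put $Y_t=aB^{H_1}_{S_t}+bB^{H_2}_{S_t}$, $t\ge0$ (the generalized mixed fractional Brownian motion time-changed by $S$). Below, $f\simeq g$ means $f(t)/g(t)\to1$ as $t\to\infty$. If $2H_1-H_2<1$, then $Y$ is long-range dependent: $E(Y_t^2)<\infty$ for all $t\ge 0$, and there are $d\in(0,1)$, not depending on $s$, and constants $c(s)\neq0$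 such that for every fixed $s>0$, $\mathrm{Corr}(Y_t,Y_s)\simeq c(s)\,t^{-d}$. More precisely, there are constants $c(s)>0$, $c_5(s)\ge0$, $c_6(s)>0$ ($s>0$), depending only on $a,b,s,\alpha,\lambda,H_1,H_2$, such that for every fixed $s>0$: 1. $\mathrm{Corr}(Y_t,Y_s)\simeq c(s)\,t^{-\min(H,\,1-H)}$, where $H=H_2$ if $b\neq0$ and $H=H_1$ if $b=0$; 2. if $b\ne0$ and $H_2\ge\frac12$, then $\mathrm{Corr}(Y_t,Y_s)\simeq c_5(s)\,t^{2H_1-H_2-1}+c_6(s)\,t^{H_2-1}$. -/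

import Mathlib

open MeasureTheory ProbabilityTheory Filter Asymptotics
open scoped NNReal Topology

noncomputable section

/-- Fractional Brownian motion with Hurst parameter `H`: a centred Gaussian process with (almost
surely) continuous sample paths, started at `0`, with the usual covariance function. -/
structure IsFractionalBrownianMotion {Ω : Type*} [MeasurableSpace Ω]
    (H : ℝ) (B : ℝ≥0 → Ω → ℝ) (P : Measure Ω) : Prop where
  measurable : ∀ t, Measurable (B t)
  gaussian : IsGaussianProcess B P
  continuous_paths : ∀ᵐ ω ∂P, Continuous fun t ↦ B t ω
  start_zero : ∀ᵐ ω ∂P, B 0 ω = 0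
  centred : ∀ t, ∫ ω, B t ω ∂P = 0
  covariance : ∀ s t : ℝ≥0, ∫ ω, B s ω * B t ω ∂P =
    (1 / 2) * ((s : ℝ) ^ (2 * H) + (t : ℝ) ^ (2 * H) - |(s : ℝ) - (t : ℝ)| ^ (2 * H))

/-- The generalized mixed process `N_t = a B¹_t + b B²_t`. -/
def gmfbm {Ω : Type*} (a b : ℝ) (B₁ B₂ : ℝ≥0 → Ω → ℝ) : ℝ≥0 → Ω → ℝ :=
  fun t ω ↦ a * B₁ t ω + b * B₂ t ω

/-- The time-changed process `Y_t = N_{S_t}`. -/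
def timeChange {Ω : Type*} (N : ℝ≥0 → Ω → ℝ) (S : ℝ≥0 → Ω → ℝ≥0) : ℝ≥0 → Ω → ℝ :=
  fun t ω ↦ N (S t ω) ω

/-- The `α`-stable density `f_α(x, t)`, for `x > 0` and `t > 0`. -/
def stableDensity (α x t : ℝ) : ℝ :=
  (1 / Real.pi) * ∫ y in Set.Ioi (0 : ℝ),
    Real.exp (-(x * y)) * Real.exp (-(t * y ^ α * Real.cos (α * Real.pi))) *
      Real.sin (t * y ^ α * Real.sin (α * Real.pi))

/-- The tempered stable density `f_{lam,α}(x, t)`, for `x > 0` and `t > 0`. -/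
def temperedStableDensity (lam α x t : ℝ) : ℝ :=
  Real.exp (-(lam * x) + lam ^ α * t) * stableDensity α x t

/-- The measure on `ℝ` with density `f_{lam,α}(·, t)` on `(0, ∞)`. -/
def temperedStableLaw (lam α t : ℝ) : Measure ℝ :=
  (volume.restrict (Set.Ioi (0 : ℝ))).withDensity
    fun x ↦ ENNReal.ofReal (temperedStableDensity lam α x t)

/-- A tempered stable subordinator: a non-negative, non-decreasing Lévy process whose value at
time `t > 0` has density `f_{lam,α}(·, t)`. -/
structure IsTemperedStableSubordinator {Ω : Type*} [MeasurableSpace Ω]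
    (lam α : ℝ) (S : ℝ≥0 → Ω → ℝ≥0) (P : Measure Ω) : Prop where
  measurable : ∀ t, Measurable (S t)
  start_zero : ∀ᵐ ω ∂P, S 0 ω = 0
  monotone_paths : ∀ᵐ ω ∂P, Monotone fun t ↦ S t ω
  right_continuous_paths : ∀ᵐ ω ∂P, ∀ t, ContinuousWithinAt (fun u ↦ S u ω) (Set.Ici t) t
  indep_increments : HasIndepIncrements (fun t ω ↦ (S t ω : ℝ)) P
  stationary_increments : ∀ s t : ℝ≥0,
    IdentDistrib (fun ω ↦ (S (s + t) ω : ℝ) - (S s ω : ℝ)) (fun ω ↦ (S t ω : ℝ)) P P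
  law : ∀ t : ℝ≥0, 0 < t → HasLaw (fun ω ↦ (S t ω : ℝ)) (temperedStableLaw lam α t) P

/-- Correlation coefficient of two real random variables. -/
def corr {Ω : Type*} [MeasurableSpace Ω] (X Y : Ω → ℝ) (P : Measure Ω) : ℝ :=
  cov[X, Y; P] / (Real.sqrt Var[X; P] * Real.sqrt Var[Y; P])

/-- Long-range dependence of a square-integrable process: there is an exponent `d ∈ (0, 1)` such
that for every fixed `s > 0`, `Corr(X_t, X_s) ∼ c(s) t^{-d}` as `t → ∞`, with `c(s) ≠ 0`. -/
def IsLongRangeDependent {Ω : Type*} [MeasurableSpace Ω]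
    (X : ℝ≥0 → Ω → ℝ) (P : Measure Ω) : Prop :=
  (∀ t, MemLp (X t) 2 P) ∧
  ∃ d : ℝ, 0 < d ∧ d < 1 ∧ ∃ c : ℝ≥0 → ℝ, ∀ s : ℝ≥0, 0 < s → c s ≠ 0 ∧
    (fun t : ℝ≥0 ↦ corr (X t) (X s) P) ~[atTop] (fun t : ℝ≥0 ↦ c s * (t : ℝ) ^ (-d))

/-- The Hurst index that dominates in `a B^{H₁} + b B^{H₂}` when `H₁ ≤ H₂`. -/
def effectiveHurst (b H₁ H₂ : ℝ) : ℝ := open Classical in if b = 0 then H₁ else H₂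

end

/-! ### Elementary inequalities for powers -/

/-! Condition on `S`. The covariance of fractional Brownian motion then turns the second moments of
`Y` into fractional moments of the subordinator. Write `m_q(t)` for the mean of `S_t ^ q`.
Stationarity of the increments of `S` gives `m_q(u)` for the mean of `|S_{s+u} - S_s| ^ q`. So the
variance of `Y_t` is `a² m_q(t)` with `q = 2H₁` plus `b² m_q(t)` with `q = 2H₂`, and the covariance
of `Y_{s+u}` and `Y_s` is the same combination of `(m_q(s+u) + m_q(s) - m_q(u)) / 2`.

Tempering makes `S_t` square integrable, so its mean and variance are linear in `t`. With `μ` the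
mean of `S_1`, concentration around `μ t` gives `m_q(t) ∼ (μ t) ^ q` (`tendsto_moment_div_rpow`).
The increment `m_q(s+u) - m_q(u)` tends to `0` for `q < 1`, equals `s μ` for `q = 1`, and is
asymptotic to `q s μ ^ q u ^ (q-1)` for `1 < q ≤ 2`. Hence the covariance bracket has exponent `max
(q-1) 0` and a positive coefficient (`tendsto_incrementCoeff`).

Covariance and variance exponents are both monotone in the Hurst index, so the larger index with a
nonzero coefficient decides both. Dividing by the standard deviation, of order `t ^ H`, leaves the
exponent `max (2H-1) 0 - H = -min H (1-H)`. The two-term form follows because its first power is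
negligible when `H₁ < H₂` and equals the second when `H₁ = H₂`. -/

lemma abs_rpow_sub_one_sub_mul_le {q x : ℝ} (hq0 : 0 ≤ q) (hq2 : q ≤ 2) (hx : 0 ≤ x) :
    |x ^ q - 1 - q * (x - 1)| ≤ (x - 1) ^ 2 := by
  have hx1 : -1 ≤ x - 1 := by linarith
  have e : 1 + (x - 1) = x := by ring
  rcases hx.eq_or_lt with rfl | hx0
  · rcases hq0.eq_or_lt with rfl | hq0
    · simp
    · rw [Real.zero_rpow hq0.ne', abs_le]
      constructor <;> nlinarith
  rcases le_total q 1 with hq1 | hq1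
  · have h1 := rpow_one_add_le_one_add_mul_self hx1 hq0 hq1
    have h2 := rpow_one_add_le_one_add_mul_self hx1 (p := 1 - q) (by linarith) (by linarith)
    rw [e] at h1 h2
    have h3 : x ^ q * x ^ (1 - q) = x := by
      rw [← Real.rpow_add hx0]; simp
    have hp1 : 0 < x ^ q := Real.rpow_pos_of_pos hx0 q
    have h4 : x ≤ x ^ q * (1 + (1 - q) * (x - 1)) := by
      calc x = x ^ q * x ^ (1 - q) := h3.symm
        _ ≤ _ := by gcongr
    have hpos : 0 < 1 + (1 - q) * (x - 1) :=
      lt_of_lt_of_le (Real.rpow_pos_of_pos hx0 (1 - q)) h2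
    rw [abs_le]
    refine ⟨?_, by nlinarith⟩
    -- The right side minus the left is exactly `(x - 1)² (q² + (1 - q) x)`. Together with `h4` this
    -- yields the lower bound after cancelling the positive factor.
    have h5 : (1 + q * (x - 1) - (x - 1) ^ 2) * (1 + (1 - q) * (x - 1)) ≤ x := by
      have : 0 ≤ (x - 1) ^ 2 * (q ^ 2 + (1 - q) * x) := by
        have : 0 ≤ (1 - q) * x := mul_nonneg (by linarith) hx
        positivity
      nlinarith
    have := le_of_mul_le_mul_right (h5.trans h4) hpos
    linarith
  · have h1 := one_add_mul_self_le_rpow_one_add hx1 hq1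
    have h2 := rpow_one_add_le_one_add_mul_self hx1 (p := q - 1) (by linarith) (by linarith)
    rw [e] at h1 h2
    have h3 : x ^ q = x * x ^ (q - 1) := by
      rw [Real.rpow_sub_one hx0.ne']; field_simp
    have h4 : x ^ q ≤ x * (1 + (q - 1) * (x - 1)) := by rw [h3]; gcongr
    rw [abs_le]
    constructor <;> nlinarith [sq_nonneg (x - 1)]

lemma rpow_add_ge_tangent {q x y : ℝ} (hq : 1 ≤ q) (hx : 0 < x) (hy : -x ≤ y) :
    x ^ q + q * x ^ (q - 1) * y ≤ (x + y) ^ q := by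
  have h := one_add_mul_self_le_rpow_one_add (s := y / x) (p := q)
    (by rw [le_div_iff₀ hx]; linarith) hq
  have h1 : (x + y) ^ q = x ^ q * (1 + y / x) ^ q := by
    rw [← Real.mul_rpow hx.le]
    · congr 1; field_simp
    · have : -1 ≤ y / x := by rw [le_div_iff₀ hx]; linarith
      linarith
  rw [h1, Real.rpow_sub_one hx.ne']
  have hxq : 0 < x ^ q := Real.rpow_pos_of_pos hx q
  calc x ^ q + q * (x ^ q / x) * y = x ^ q * (1 + q * (y / x)) := by field_simp
    _ ≤ _ := by gcongr

lemma mul_rpow_sub_one_le_rpow_add_sub {q x y : ℝ} (hq : 1 < q) (hx : 0 ≤ x) (hy : 0 ≤ y) :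
    q * x ^ (q - 1) * y ≤ (x + y) ^ q - x ^ q := by
  rcases hx.eq_or_lt with rfl | hx
  · rw [Real.zero_rpow (by linarith), Real.zero_rpow (by linarith)]
    simpa using Real.rpow_nonneg hy q
  · have := rpow_add_ge_tangent hq.le hx (y := y) (by linarith)
    linarith

/-- Convexity puts the graph above its tangent at `x + y`; reading that tangent at `x` gives slope
`q (x + y) ^ (q - 1)`. Since `q - 1 ≤ 1`, subadditivity splits this slope, and the error `q y ^ q`
does not involve `x`. -/
lemma rpow_add_sub_le {q x y : ℝ} (hq : 1 < q) (hq2 : q ≤ 2) (hx : 0 ≤ x) (hy : 0 ≤ y) :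
    (x + y) ^ q - x ^ q ≤ q * x ^ (q - 1) * y + q * y ^ q := by
  rcases hy.eq_or_lt with rfl | hy
  · simp [Real.zero_rpow (by linarith : q ≠ 0)]
  have h := rpow_add_ge_tangent hq.le (x := x + y) (y := -y) (by linarith) (by linarith)
  have h2 : (x + y) ^ (q - 1) ≤ x ^ (q - 1) + y ^ (q - 1) :=
    Real.rpow_add_le_add_rpow hx hy.le (by linarith) (by linarith)
  have h3 : y ^ q = y ^ (q - 1) * y := by
    rw [Real.rpow_sub_one hy.ne']; field_simp
  have h4 : q * (x + y) ^ (q - 1) * y ≤ q * (x ^ (q - 1) + y ^ (q - 1)) * y := by gcongr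
  have h5 : x + y + -y = x := by ring
  rw [h5] at h
  rw [h3]
  linarith

/-- Below the level `M` subadditivity is enough; above it the concave power has slope at most `M ^
(q - 1)`. For a subordinator the first term dies as time grows, the second as `M` grows. -/
lemma rpow_add_sub_le_indicator {q x y M : ℝ} (hq0 : 0 < q) (hq : q ≤ 1) (hx : 0 ≤ x)
    (hy : 0 ≤ y) (hM : 0 < M) :
    (x + y) ^ q - x ^ q ≤ (Set.Iic M).indicator 1 x * y ^ q + M ^ (q - 1) * y := by
  by_cases h : x ≤ M
  · have := Real.rpow_add_le_add_rpow hx hy hq0.le hq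
    have h2 : 0 ≤ M ^ (q - 1) * y := by positivity
    simp only [Set.indicator_of_mem (Set.mem_Iic.2 h), Pi.one_apply, one_mul]
    linarith
  · have hMx : M < x := not_le.1 h
    have hx0 : 0 < x := hM.trans hMx
    have h1 := rpow_one_add_le_one_add_mul_self (s := y / x)
      (by have : 0 ≤ y / x := by positivity
          linarith) hq0.le hq
    have h2 : (x + y) ^ q = x ^ q * (1 + y / x) ^ q := by
      rw [← Real.mul_rpow hx0.le (by positivity)]
      congr 1; field_simp
    have h3 : x ^ (q - 1) ≤ M ^ (q - 1) :=
      Real.rpow_le_rpow_of_nonpos hM hMx.le (by linarith)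
    have hxq : 0 < x ^ q := Real.rpow_pos_of_pos hx0 q
    rw [Set.indicator_of_notMem (by simpa using hMx), zero_mul, zero_add, h2]
    calc x ^ q * (1 + y / x) ^ q - x ^ q ≤ x ^ q * (1 + q * (y / x)) - x ^ q := by gcongr
      _ = q * (x ^ (q - 1) * y) := by rw [Real.rpow_sub_one hx0.ne']; field_simp; ring
      _ ≤ 1 * (x ^ (q - 1) * y) := by gcongr
      _ ≤ _ := by rw [one_mul]; gcongr

/-- Cauchy's functional equation, with nonnegativity supplying monotonicity. It makes the mean and
variance of a subordinator linear in time. -/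
lemma eq_mul_of_additive_nonneg {f : ℝ≥0 → ℝ} (hadd : ∀ s t, f (s + t) = f s + f t)
    (hf : ∀ t, 0 ≤ f t) (t : ℝ≥0) : f t = t * f 1 := by
  have hmono : Monotone f := fun s t h ↦ by
    obtain ⟨r, rfl⟩ := exists_add_of_le h
    rw [hadd]; linarith [hf r]
  have h0 : f 0 = 0 := by have := hadd 0 0; simp at this; exact this
  have hnat : ∀ (n : ℕ) (r : ℝ≥0), f (n * r) = n * f r := fun n r ↦ by
    induction n with
    | zero => simp [h0]
    | succ n ih => push_cast; rw [add_mul, one_mul, hadd, ih]; ring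
  -- Squeezing `n t` between consecutive integers bounds the defect from linearity, multiplied by
  -- `n`, uniformly in `n`; so the defect is zero.
  have hb : ∀ n : ℕ, |n * (f t - t * f 1)| ≤ f 1 := fun n ↦ by
    have e : n * f t = f (n * t) := (hnat n t).symm
    have h1 : f (⌊(n : ℝ≥0) * t⌋₊ * 1) ≤ f (n * t) := hmono (by
      rw [mul_one]; exact Nat.floor_le zero_le)
    have h2 : f (n * t) ≤ f ((⌊(n : ℝ≥0) * t⌋₊ + 1 : ℕ) * 1) := hmono (by
      rw [mul_one]; exact_mod_cast (Nat.lt_floor_add_one ((n : ℝ≥0) * t)).le)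
    rw [hnat _ 1] at h1 h2
    have h3 : ((⌊(n : ℝ≥0) * t⌋₊ : ℝ≥0) : ℝ) ≤ n * t := by
      exact_mod_cast Nat.floor_le (zero_le (a := (n : ℝ≥0) * t))
    have h4 : (n : ℝ) * t ≤ (⌊(n : ℝ≥0) * t⌋₊ : ℝ≥0) + 1 := by
      exact_mod_cast (Nat.lt_floor_add_one ((n : ℝ≥0) * t)).le
    push_cast at h1 h2 h3 h4
    have := hf 1
    rw [mul_sub, e, abs_le]
    constructor <;> nlinarith
  by_contra hne
  have hpos : 0 < |f t - t * f 1| := abs_pos.2 (sub_ne_zero.2 hne)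
  obtain ⟨n, hn⟩ := exists_nat_gt (f 1 / |f t - t * f 1|)
  have := hb n
  rw [abs_mul, Nat.abs_cast] at this
  rw [div_lt_iff₀ hpos] at hn
  linarith

/-! ### Moments of square-integrable subordinators -/

/-- A square-integrable subordinator: a non-negative, non-decreasing process with independent and
stationary increments, started at `0`, whose marginals have a second moment. -/
structure IsSqIntegrableSubordinator {Ω : Type*} [MeasurableSpace Ω]
    (T : ℝ≥0 → Ω → ℝ) (P : Measure Ω) : Prop where
  measurable : ∀ t, Measurable (T t)
  nonneg : ∀ t ω, 0 ≤ T t ω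
  start_zero : ∀ᵐ ω ∂P, T 0 ω = 0
  mono : ∀ s t, s ≤ t → ∀ᵐ ω ∂P, T s ω ≤ T t ω
  indep : HasIndepIncrements T P
  stationary : ∀ s t, IdentDistrib (fun ω ↦ T (s + t) ω - T s ω) (T t) P P
  memLp : ∀ t, MemLp (T t) 2 P

namespace IsSqIntegrableSubordinator

variable {Ω : Type*} [MeasurableSpace Ω] {P : Measure Ω}
  {T : ℝ≥0 → Ω → ℝ}

lemma integrable [IsProbabilityMeasure P] (h : IsSqIntegrableSubordinator T P) (t : ℝ≥0) : Integrable (T t) P :=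
  (h.memLp t).integrable one_le_two

lemma integrable_rpow [IsProbabilityMeasure P] (h : IsSqIntegrableSubordinator T P) (t : ℝ≥0) {q : ℝ} (hq0 : 0 ≤ q)
    (hq2 : q ≤ 2) : Integrable (fun ω ↦ T t ω ^ q) P := by
  refine ((integrable_const (1 : ℝ)).add (h.memLp t).integrable_sq).mono'
    ((h.measurable t).pow_const q).aestronglyMeasurable (.of_forall fun ω ↦ ?_)
  have hx := h.nonneg t ω
  rw [Real.norm_of_nonneg (Real.rpow_nonneg hx q)]
  simp only [Pi.add_apply]
  rcases le_total (T t ω) 1 with h1 | h1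
  · have := Real.rpow_le_one hx h1 hq0
    nlinarith [sq_nonneg (T t ω)]
  · have := Real.rpow_le_rpow_of_exponent_le h1 hq2
    rw [Real.rpow_two] at this
    linarith

lemma indepFun (h : IsSqIntegrableSubordinator T P) (u s : ℝ≥0) :
    IndepFun (T u) (fun ω ↦ T (u + s) ω - T u ω) P :=
  h.indep.indepFun_eval_sub (zero_le (a := u)) le_self_add h.start_zero

lemma integral_add [IsProbabilityMeasure P] (h : IsSqIntegrableSubordinator T P) (u s : ℝ≥0) :
    ∫ ω, T (u + s) ω ∂P = ∫ ω, T u ω ∂P + ∫ ω, T s ω ∂P := by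
  rw [← (h.stationary u s).integral_eq, integral_sub (h.integrable _) (h.integrable _)]
  ring

lemma variance_add [IsProbabilityMeasure P] (h : IsSqIntegrableSubordinator T P) (u s : ℝ≥0) :
    Var[T (u + s); P] = Var[T u; P] + Var[T s; P] := by
  have := (h.indepFun u s).variance_add (h.memLp u) ((h.memLp (u + s)).sub (h.memLp u))
  have e := (h.stationary u s).variance_eq
  change Var[T (u + s) - T u; P] = Var[T s; P] at e
  rw [← e, ← this]
  congr 1
  ext ω
  simp

lemma integral_eq [IsProbabilityMeasure P] (h : IsSqIntegrableSubordinator T P) (t : ℝ≥0) :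
    ∫ ω, T t ω ∂P = t * ∫ ω, T 1 ω ∂P :=
  eq_mul_of_additive_nonneg h.integral_add (fun t ↦ integral_nonneg (h.nonneg t)) t

lemma variance_eq [IsProbabilityMeasure P] (h : IsSqIntegrableSubordinator T P) (t : ℝ≥0) :
    Var[T t; P] = t * Var[T 1; P] :=
  eq_mul_of_additive_nonneg h.variance_add (fun _ ↦ variance_nonneg _ _) t

/-- The normalised variable `T_t / (t μ)` has mean `1` and variance of order `1 / t`. A second-order
estimate of the power around `1` then controls every moment of order at most `2`. -/
lemma tendsto_moment_div_rpow [IsProbabilityMeasure P] (h : IsSqIntegrableSubordinator T P)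
    (hμ : 0 < ∫ ω, T 1 ω ∂P) {q : ℝ} (hq0 : 0 ≤ q) (hq2 : q ≤ 2) :
    Tendsto (fun t : ℝ≥0 ↦ (∫ ω, T t ω ^ q ∂P) / (t : ℝ) ^ q) atTop
      (𝓝 ((∫ ω, T 1 ω ∂P) ^ q)) := by
  set μ := ∫ ω, T 1 ω ∂P with hμdef
  have key : ∀ t : ℝ≥0, 0 < t →
      |(∫ ω, T t ω ^ q ∂P) / ((t : ℝ) * μ) ^ q - 1| ≤ (Var[T 1; P] / μ ^ 2) * (t : ℝ)⁻¹ := by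
    intro t ht
    have ht' : (0 : ℝ) < t := ht
    have hm : 0 < (t : ℝ) * μ := by positivity
    have hq1 : (0 : ℝ) < ((t : ℝ) * μ) ^ q := Real.rpow_pos_of_pos hm q
    have i1 := (h.integrable t).div_const ((t : ℝ) * μ)
    have i2 : Integrable (fun ω ↦ (T t ω / (t * μ)) ^ q) P := by
      simp_rw [Real.div_rpow (h.nonneg t _) hm.le]
      exact (h.integrable_rpow t hq0 hq2).div_const _
    have i2' : Integrable (fun ω ↦ (T t ω / (t * μ)) ^ q - 1) P := i2.sub (integrable_const 1)
    have i1' : Integrable (fun ω ↦ T t ω / (t * μ) - 1) P := i1.sub (integrable_const 1)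
    have i3 : Integrable (fun ω ↦ (T t ω / (t * μ)) ^ q - 1 - q * (T t ω / (t * μ) - 1)) P :=
      i2'.sub (i1'.const_mul q)
    -- The linear term has mean zero, so subtracting it is free and leaves a quadratic remainder.
    have e1 : (∫ ω, T t ω ^ q ∂P) / ((t : ℝ) * μ) ^ q - 1 =
        ∫ ω, ((T t ω / (t * μ)) ^ q - 1 - q * (T t ω / (t * μ) - 1)) ∂P := by
      rw [MeasureTheory.integral_sub i2' (i1'.const_mul q),
        MeasureTheory.integral_sub i2 (integrable_const _), integral_const_mul,
        MeasureTheory.integral_sub i1 (integrable_const _), integral_div, h.integral_eq,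
        ← hμdef, div_self hm.ne']
      simp_rw [Real.div_rpow (h.nonneg t _) hm.le]
      rw [integral_div]
      simp
    have e2 : ∫ ω, (T t ω / (t * μ) - 1) ^ 2 ∂P = Var[T 1; P] / μ ^ 2 * (t : ℝ)⁻¹ := by
      have : ∀ ω, (T t ω / (t * μ) - 1) ^ 2 = (T t ω - t * μ) ^ 2 / (t * μ) ^ 2 := fun ω ↦ by
        field_simp
      simp_rw [this]
      rw [integral_div, ← h.integral_eq, ← variance_eq_integral (h.measurable t).aemeasurable,
        h.variance_eq, h.integral_eq, ← hμdef]
      field_simp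
    have i4 : Integrable (fun ω ↦ (T t ω / (t * μ) - 1) ^ 2) P :=
      by
      have : MemLp (fun ω ↦ T t ω / (t * μ) - 1) 2 P := by
        simp_rw [div_eq_mul_inv]
        exact ((h.memLp t).mul_const _).sub (memLp_const 1)
      exact this.integrable_sq
    rw [e1, ← e2]
    refine abs_integral_le_integral_abs.trans (integral_mono i3.abs i4 fun ω ↦ ?_)
    exact abs_rpow_sub_one_sub_mul_le hq0 hq2 (div_nonneg (h.nonneg t ω) hm.le)
  have htop : Tendsto (fun t : ℝ≥0 ↦ (t : ℝ)) atTop atTop := NNReal.tendsto_coe_atTop.2 tendsto_id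
  have h0 : Tendsto (fun t : ℝ≥0 ↦ (Var[T 1; P] / μ ^ 2) * (t : ℝ)⁻¹) atTop (𝓝 0) := by
    simpa using (tendsto_inv_atTop_zero.comp htop).const_mul (Var[T 1; P] / μ ^ 2)
  have h1 : Tendsto (fun t : ℝ≥0 ↦ (∫ ω, T t ω ^ q ∂P) / ((t : ℝ) * μ) ^ q) atTop (𝓝 1) := by
    rw [tendsto_iff_norm_sub_tendsto_zero]
    refine squeeze_zero' (.of_forall fun _ ↦ norm_nonneg _) ?_ h0
    filter_upwards [eventually_gt_atTop 0] with t ht using key t ht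
  have h2 := h1.mul_const (μ ^ q)
  rw [one_mul] at h2
  refine h2.congr' ?_
  filter_upwards [eventually_gt_atTop 0] with t ht
  have ht' : (0 : ℝ) < t := ht
  have hq1 : (0 : ℝ) < μ ^ q := Real.rpow_pos_of_pos hμ q
  rw [Real.mul_rpow ht'.le hμ.le]
  field_simp

lemma integral_increment (h : IsSqIntegrableSubordinator T P) (u s : ℝ≥0) {f g : ℝ → ℝ}
    (hf : Measurable f) (hg : Measurable g) :
    ∫ ω, f (T u ω) * g (T (u + s) ω - T u ω) ∂P =
      (∫ ω, f (T u ω) ∂P) * ∫ ω, g (T s ω) ∂P := by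
  rw [(h.indepFun u s).integral_fun_comp_mul_comp (h.measurable u).aemeasurable
    ((h.measurable _).sub (h.measurable _)).aemeasurable hf.aestronglyMeasurable
    hg.aestronglyMeasurable]
  congr 1
  exact ((h.stationary u s).comp hg).integral_eq

lemma integrable_increment (h : IsSqIntegrableSubordinator T P) (u s : ℝ≥0) {f g : ℝ → ℝ}
    (hf : Measurable f) (hg : Measurable g) (hfi : Integrable (fun ω ↦ f (T u ω)) P)
    (hgi : Integrable (fun ω ↦ g (T s ω)) P) :
    Integrable (fun ω ↦ f (T u ω) * g (T (u + s) ω - T u ω)) P :=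
  ((h.indepFun u s).comp hf hg).integrable_mul hfi
    (((h.stationary u s).comp hg).integrable_iff.2 hgi)

lemma integral_rpow_sub_eq (h : IsSqIntegrableSubordinator T P) (u s : ℝ≥0) (q : ℝ) :
    ∫ ω, |T (u + s) ω - T u ω| ^ q ∂P = ∫ ω, T s ω ^ q ∂P := by
  have := ((h.stationary u s).comp (u := fun x ↦ |x| ^ q) (by fun_prop)).integral_eq
  refine this.trans (integral_congr_ae (.of_forall fun ω ↦ ?_))
  simp [abs_of_nonneg (h.nonneg s ω)]

lemma integrable_rpow_sub [IsProbabilityMeasure P] (h : IsSqIntegrableSubordinator T P) (u s : ℝ≥0) {q : ℝ}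
    (hq0 : 0 ≤ q) (hq2 : q ≤ 2) : Integrable (fun ω ↦ |T (u + s) ω - T u ω| ^ q) P := by
  have := ((h.stationary u s).comp (u := fun x ↦ |x| ^ q) (by fun_prop)).integrable_iff.2
    ((h.integrable_rpow s hq0 hq2).congr (.of_forall fun ω ↦ by
      simp [abs_of_nonneg (h.nonneg s ω)]))
  exact this

lemma tendsto_measureReal_le [IsProbabilityMeasure P] (h : IsSqIntegrableSubordinator T P)
    (hμ : 0 < ∫ ω, T 1 ω ∂P) (M : ℝ) :
    Tendsto (fun t : ℝ≥0 ↦ P.real {ω | T t ω ≤ M}) atTop (𝓝 0) := by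
  set μ := ∫ ω, T 1 ω ∂P with hμdef
  have htop : Tendsto (fun t : ℝ≥0 ↦ (t : ℝ)) atTop atTop := NNReal.tendsto_coe_atTop.2 tendsto_id
  have h0 : Tendsto (fun t : ℝ≥0 ↦ (4 * Var[T 1; P] / μ ^ 2) * (t : ℝ)⁻¹) atTop (𝓝 0) := by
    simpa using (tendsto_inv_atTop_zero.comp htop).const_mul (4 * Var[T 1; P] / μ ^ 2)
  refine squeeze_zero' (.of_forall fun _ ↦ measureReal_nonneg) ?_ h0
  -- Beyond `2M / μ` the mean is at least `2M`, so being below `M` is a deviation of at least half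
  -- the mean, to which Chebyshev applies.
  filter_upwards [eventually_gt_atTop 0, htop.eventually_ge_atTop (2 * M / μ)] with t ht htM
  have ht' : (0 : ℝ) < t := ht
  have hc : 0 < t * μ / 2 := by positivity
  have hM : M ≤ t * μ / 2 := by
    rw [div_le_iff₀ hμ] at htM; linarith
  have hcheb := meas_ge_le_variance_div_sq (h.memLp t) hc
  have hsub : {ω | T t ω ≤ M} ⊆ {ω | t * μ / 2 ≤ |T t ω - ∫ ω, T t ω ∂P|} := fun ω hω ↦ by
    simp only [Set.mem_ofPred_eq] at hω ⊢
    rw [h.integral_eq, ← hμdef, abs_sub_comm]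
    exact le_trans (by linarith) (le_abs_self _)
  have := ENNReal.toReal_mono (by simp) ((measure_mono hsub).trans hcheb)
  rw [ENNReal.toReal_ofReal (by have := variance_nonneg (T t) P; positivity), h.variance_eq] at this
  refine this.trans_eq ?_
  field_simp
  norm_num

lemma tendsto_moment_increment_of_lt_one [IsProbabilityMeasure P]
    (h : IsSqIntegrableSubordinator T P)
    (hμ : 0 < ∫ ω, T 1 ω ∂P) {q : ℝ} (hq0 : 0 < q) (hq : q < 1) (s : ℝ≥0) :
    Tendsto (fun u : ℝ≥0 ↦ ∫ ω, T (u + s) ω ^ q ∂P - ∫ ω, T u ω ^ q ∂P) atTop (𝓝 0) := by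
  have hnn : ∀ u : ℝ≥0, 0 ≤ ∫ ω, T (u + s) ω ^ q ∂P - ∫ ω, T u ω ^ q ∂P := fun u ↦ by
    rw [sub_nonneg]
    refine integral_mono_ae (h.integrable_rpow _ hq0.le (by linarith))
      (h.integrable_rpow _ hq0.le (by linarith)) ?_
    filter_upwards [h.mono u (u + s) le_self_add] with ω hω
    exact Real.rpow_le_rpow (h.nonneg u ω) hω hq0.le
  have hbd : ∀ M : ℝ, 0 < M → ∀ u : ℝ≥0, ∫ ω, T (u + s) ω ^ q ∂P - ∫ ω, T u ω ^ q ∂P ≤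
      P.real {ω | T u ω ≤ M} * (∫ ω, T s ω ^ q ∂P) + M ^ (q - 1) * ∫ ω, T s ω ∂P := by
    intro M hM u
    have hfm : Measurable ((Set.Iic M).indicator (1 : ℝ → ℝ)) :=
      measurable_one.indicator measurableSet_Iic
    have hfi : Integrable (fun ω ↦ (Set.Iic M).indicator (1 : ℝ → ℝ) (T u ω)) P :=
      ((integrable_const (1 : ℝ)).indicator ((h.measurable u) (measurableSet_Iic (a := M)))).congr
        (.of_forall fun ω ↦ rfl)
    have i1 := h.integrable_increment u s hfm (g := fun x ↦ x ^ q) (by fun_prop) hfi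
      (h.integrable_rpow s hq0.le (by linarith))
    have i2 : Integrable (fun ω ↦ M ^ (q - 1) * (T (u + s) ω - T u ω)) P :=
      ((h.integrable _).sub (h.integrable _)).const_mul _
    have e1 := h.integral_increment u s hfm (g := fun x ↦ x ^ q) (by fun_prop)
    have e3 : ∫ ω, (Set.Iic M).indicator (1 : ℝ → ℝ) (T u ω) ∂P = P.real {ω | T u ω ≤ M} :=
      integral_indicator_one (h.measurable u (measurableSet_Iic (a := M)))
    rw [e3] at e1
    rw [← e1, ← (h.stationary u s).integral_eq, ← integral_const_mul, ← integral_sub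
      (h.integrable_rpow _ hq0.le (by linarith)) (h.integrable_rpow _ hq0.le (by linarith)),
      ← MeasureTheory.integral_add i1 i2]
    refine integral_mono_ae ((h.integrable_rpow _ hq0.le (by linarith)).sub
      (h.integrable_rpow _ hq0.le (by linarith))) (i1.add i2) ?_
    filter_upwards [h.mono u (u + s) le_self_add] with ω hω
    have := rpow_add_sub_le_indicator hq0 hq.le (h.nonneg u ω) (sub_nonneg.2 hω) hM
    simpa using this
  refine tendsto_order.2 ⟨fun a ha ↦ .of_forall fun u ↦ ha.trans_le (hnn u), fun ε hε ↦ ?_⟩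
  -- The order of choices matters: first `M` makes the slope term small uniformly in `u`, then large
  -- `u` makes the probability of lying below that fixed `M` small.
  have hMlim : Tendsto (fun M : ℝ ↦ M ^ (q - 1) * ∫ ω, T s ω ∂P) atTop (𝓝 0) := by
    simpa using (tendsto_rpow_neg_atTop (y := 1 - q) (by linarith)).mul_const (∫ ω, T s ω ∂P)
  obtain ⟨M, hM, hM0⟩ := ((hMlim.eventually_lt_const (half_pos hε)).and
    (eventually_gt_atTop 0)).exists
  have hPlim := (h.tendsto_measureReal_le hμ M).mul_const (∫ ω, T s ω ^ q ∂P)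
  rw [zero_mul] at hPlim
  filter_upwards [hPlim.eventually_lt_const (half_pos hε)] with u hu
  linarith [hbd M hM0 u]

/-- By independence and stationarity of increments, the pathwise tangent bounds integrate to a main
term, a product of the moments of order `q - 1` at `u` and of order `1` at `s`. The two bounds
differ by a constant, which is negligible against `u ^ (q - 1)`. -/
lemma tendsto_moment_increment_of_one_lt [IsProbabilityMeasure P]
    (h : IsSqIntegrableSubordinator T P)
    (hμ : 0 < ∫ ω, T 1 ω ∂P) {q : ℝ} (hq : 1 < q) (hq2 : q ≤ 2) (s : ℝ≥0) :
    Tendsto (fun u : ℝ≥0 ↦ (∫ ω, T (u + s) ω ^ q ∂P - ∫ ω, T u ω ^ q ∂P) / (u : ℝ) ^ (q - 1))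
      atTop (𝓝 (q * s * (∫ ω, T 1 ω ∂P) ^ q)) := by
  have htop : Tendsto (fun t : ℝ≥0 ↦ (t : ℝ)) atTop atTop := NNReal.tendsto_coe_atTop.2 tendsto_id
  have i0 : ∀ u, Integrable (fun ω ↦ T u ω ^ q) P := fun u ↦
    h.integrable_rpow u (by linarith) hq2
  have i1 : ∀ u, Integrable (fun ω ↦ T u ω ^ (q - 1) * (T (u + s) ω - T u ω)) P := fun u ↦
    h.integrable_increment u s (f := fun x ↦ x ^ (q - 1)) (by fun_prop) measurable_id
      (h.integrable_rpow u (by linarith) (by linarith)) (h.integrable s)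
  have e1 : ∀ u, ∫ ω, q * (T u ω ^ (q - 1) * (T (u + s) ω - T u ω)) ∂P =
      q * ((∫ ω, T u ω ^ (q - 1) ∂P) * ∫ ω, T s ω ∂P) := fun u ↦ by
    rw [integral_const_mul]
    congr 1
    exact h.integral_increment u s (f := fun x ↦ x ^ (q - 1)) (by fun_prop) measurable_id
  have hlow : ∀ u, q * ((∫ ω, T u ω ^ (q - 1) ∂P) * ∫ ω, T s ω ∂P) ≤
      ∫ ω, T (u + s) ω ^ q ∂P - ∫ ω, T u ω ^ q ∂P := fun u ↦ by
    rw [← e1, ← integral_sub (i0 _) (i0 _)]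
    refine integral_mono_ae ((i1 u).const_mul q) ((i0 _).sub (i0 _)) ?_
    filter_upwards [h.mono u (u + s) le_self_add] with ω hω
    have := mul_rpow_sub_one_le_rpow_add_sub hq (h.nonneg u ω) (sub_nonneg.2 hω)
    simpa [mul_assoc] using this
  have hup : ∀ u, ∫ ω, T (u + s) ω ^ q ∂P - ∫ ω, T u ω ^ q ∂P ≤
      q * ((∫ ω, T u ω ^ (q - 1) ∂P) * ∫ ω, T s ω ∂P) + q * ∫ ω, T s ω ^ q ∂P := fun u ↦ by
    have i2 := (h.integrable_rpow_sub u s (by linarith) hq2).const_mul q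
    rw [← e1, ← h.integral_rpow_sub_eq u s q, ← integral_const_mul q (fun ω ↦ |_| ^ q),
      ← integral_sub (i0 _) (i0 _), ← MeasureTheory.integral_add ((i1 u).const_mul q) i2]
    refine integral_mono_ae ((i0 _).sub (i0 _)) (((i1 u).const_mul q).add i2) ?_
    filter_upwards [h.mono u (u + s) le_self_add] with ω hω
    have := rpow_add_sub_le hq hq2 (h.nonneg u ω) (sub_nonneg.2 hω)
    simpa [mul_assoc, abs_of_nonneg (sub_nonneg.2 hω)] using this
  have hlim : Tendsto (fun u : ℝ≥0 ↦ q * ((∫ ω, T u ω ^ (q - 1) ∂P) * ∫ ω, T s ω ∂P) /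
      (u : ℝ) ^ (q - 1)) atTop (𝓝 (q * s * (∫ ω, T 1 ω ∂P) ^ q)) := by
    have := (h.tendsto_moment_div_rpow hμ (q := q - 1) (by linarith) (by linarith)).const_mul
      (q * ∫ ω, T s ω ∂P)
    have e : (q * ∫ ω, T s ω ∂P) * (∫ ω, T 1 ω ∂P) ^ (q - 1) =
        q * s * (∫ ω, T 1 ω ∂P) ^ q := by
      rw [h.integral_eq s, Real.rpow_sub_one hμ.ne']; field_simp
    rw [e] at this
    exact this.congr fun u ↦ by ring
  have hlim2 : Tendsto (fun u : ℝ≥0 ↦ (q * ((∫ ω, T u ω ^ (q - 1) ∂P) * ∫ ω, T s ω ∂P) +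
      q * ∫ ω, T s ω ^ q ∂P) / (u : ℝ) ^ (q - 1)) atTop
      (𝓝 (q * s * (∫ ω, T 1 ω ∂P) ^ q)) := by
    have := hlim.add (((tendsto_rpow_neg_atTop (y := q - 1) (by linarith)).comp htop).const_mul
      (q * ∫ ω, T s ω ^ q ∂P))
    rw [mul_zero, add_zero] at this
    refine this.congr fun u ↦ ?_
    simp only [Function.comp_apply]
    rw [Real.rpow_neg u.coe_nonneg, add_div, div_eq_mul_inv (q * ∫ ω, T s ω ^ q ∂P)]
  refine tendsto_of_tendsto_of_tendsto_of_le_of_le hlim hlim2 (fun u ↦ ?_) (fun u ↦ ?_)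
  · have := hlow u
    dsimp only
    gcongr
  · have := hup u
    dsimp only
    gcongr

end IsSqIntegrableSubordinator

/-! ### Second moments of a process evaluated at an independent random time -/

/-- A jointly measurable functional that evaluates continuous paths. -/
noncomputable def pathEval (p : ℝ≥0 → ℝ) (r : ℝ≥0) : ℝ :=
  limsup (fun n : ℕ ↦ p ((⌊((n : ℝ≥0) + 1) * r⌋₊ : ℝ≥0) / ((n : ℝ≥0) + 1))) atTop

/-- Evaluation is not jointly measurable on the space of all functions with the product σ-algebra.
Each approximant reads the path at a countable grid only, so it is measurable, and a limsup of such
functions stays measurable even on discontinuous paths. -/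
lemma measurable_pathEval : Measurable fun x : (ℝ≥0 → ℝ) × ℝ≥0 ↦ pathEval x.1 x.2 := by
  refine Measurable.limsup fun n ↦ ?_
  have h1 : Measurable fun y : (ℝ≥0 → ℝ) × ℕ ↦ y.1 ((y.2 : ℝ≥0) / ((n : ℝ≥0) + 1)) :=
    measurable_from_prod_countable_left fun k ↦
      measurable_pi_apply ((k : ℝ≥0) / ((n : ℝ≥0) + 1))
  exact h1.comp (measurable_fst.prodMk
    (Nat.measurable_floor.comp (measurable_snd.const_mul _)))

lemma pathEval_eq {p : ℝ≥0 → ℝ} (hp : Continuous p) (r : ℝ≥0) : pathEval p r = p r := by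
  refine Tendsto.limsup_eq ((hp.tendsto r).comp ?_)
  -- The grid point lies between `r - 1/(n+1)` and `r`. Truncated subtraction is harmless for the
  -- lower bound.
  have h1 : Tendsto (fun n : ℕ ↦ r - 1 / ((n : ℝ≥0) + 1)) atTop (𝓝 r) := by
    have : Tendsto (fun n : ℕ ↦ 1 / ((n : ℝ≥0) + 1)) atTop (𝓝 0) :=
      NNReal.tendsto_coe.1 (by simpa using tendsto_one_div_add_atTop_nhds_zero_nat (𝕜 := ℝ))
    simpa using tendsto_const_nhds.sub this
  refine tendsto_of_tendsto_of_tendsto_of_le_of_le h1 tendsto_const_nhds (fun n ↦ ?_) fun n ↦ ?_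
  · have := (Nat.lt_floor_add_one (((n : ℝ≥0) + 1) * r)).le
    have hn : (0 : ℝ≥0) < (n : ℝ≥0) + 1 := by positivity
    dsimp only
    rw [tsub_le_iff_right, ← add_div, le_div_iff₀ hn, mul_comm]
    exact this
  · have hn : (0 : ℝ≥0) < (n : ℝ≥0) + 1 := by positivity
    dsimp only
    rw [div_le_iff₀ hn, mul_comm]
    exact Nat.floor_le zero_le

attribute [irreducible] pathEval

section TimeChange

variable {Ω : Type*} [MeasurableSpace Ω] {P : Measure Ω} {X : ℝ≥0 → Ω → ℝ} {S : ℝ≥0 → Ω → ℝ≥0}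

lemma timeChange_ae_eq_pathEval (hXc : ∀ᵐ ω ∂P, Continuous fun t ↦ X t ω) (t : ℝ≥0) :
    timeChange X S t =ᵐ[P] fun ω ↦ pathEval (fun r ↦ X r ω) (S t ω) := by
  filter_upwards [hXc] with ω hω
  exact (pathEval_eq hω _).symm

lemma measurable_pathEval_comp (hXm : ∀ t, Measurable (X t)) (hS : ∀ t, Measurable (S t))
    (t : ℝ≥0) : Measurable fun ω ↦ pathEval (fun r ↦ X r ω) (S t ω) := by
  have h : Measurable fun ω ↦ ((fun r ↦ X r ω), S t ω) :=
    (measurable_pi_lambda _ hXm).prodMk (hS t)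
  exact measurable_pathEval.comp h

lemma aemeasurable_timeChange (hXm : ∀ t, Measurable (X t))
    (hXc : ∀ᵐ ω ∂P, Continuous fun t ↦ X t ω) (hS : ∀ t, Measurable (S t)) (t : ℝ≥0) :
    AEMeasurable (timeChange X S t) P :=
  (measurable_pathEval_comp hXm hS t).aemeasurable.congr (timeChange_ae_eq_pathEval hXc t).symm

lemma measurable_pathEval_pair {E : Type*} [MeasurableSpace E] {g : ℝ × ℝ → E}
    (hg : Measurable g) (s t : ℝ≥0) :
    Measurable fun x : (ℝ≥0 → ℝ) × (ℝ≥0 → ℝ≥0) ↦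
      g (pathEval x.1 (x.2 s), pathEval x.1 (x.2 t)) := by
  have h : ∀ t, Measurable fun x : (ℝ≥0 → ℝ) × (ℝ≥0 → ℝ≥0) ↦ (x.1, x.2 t) := fun t ↦
    measurable_fst.prodMk ((measurable_pi_apply t).comp measurable_snd)
  exact hg.comp ((measurable_pathEval.comp (h s)).prodMk (measurable_pathEval.comp (h t)))

variable [IsProbabilityMeasure P]

/-- By independence the joint law of path and clock is a product, so Tonelli freezes the clock. The
nonnegative version needs no integrability and is what proves square integrability. -/
lemma lintegral_timeChange (hXm : ∀ t, Measurable (X t))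
    (hXc : ∀ᵐ ω ∂P, Continuous fun t ↦ X t ω) (hS : ∀ t, Measurable (S t))
    (hind : IndepFun (fun ω t ↦ X t ω) (fun ω t ↦ S t ω) P) {g : ℝ × ℝ → ENNReal}
    (hg : Measurable g) (s t : ℝ≥0) :
    ∫⁻ ω, g (timeChange X S s ω, timeChange X S t ω) ∂P =
      ∫⁻ ω', ∫⁻ ω, g (X (S s ω') ω, X (S t ω') ω) ∂P ∂P := by
  have mX : Measurable fun ω t ↦ X t ω := measurable_pi_lambda _ hXm
  have mS : Measurable fun ω t ↦ S t ω := measurable_pi_lambda _ hS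
  have hF := measurable_pathEval_pair hg s t
  have hmap := (indepFun_iff_map_prod_eq_prod_map_map mX.aemeasurable mS.aemeasurable).1 hind
  have := Measure.isProbabilityMeasure_map (μ := P) mX.aemeasurable
  have := Measure.isProbabilityMeasure_map (μ := P) mS.aemeasurable
  calc ∫⁻ ω, g (timeChange X S s ω, timeChange X S t ω) ∂P
      = ∫⁻ x, g (pathEval x.1 (x.2 s), pathEval x.1 (x.2 t))
          ∂(P.map fun ω ↦ (fun t ↦ X t ω, fun t ↦ S t ω)) := by
        rw [lintegral_map hF (mX.prodMk mS)]
        refine lintegral_congr_ae ?_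
        filter_upwards [timeChange_ae_eq_pathEval hXc s (S := S),
          timeChange_ae_eq_pathEval hXc t (S := S)] with ω h1 h2
        rw [h1, h2]
    _ = ∫⁻ ω', ∫⁻ ω, g (pathEval (fun r ↦ X r ω) (S s ω'), pathEval (fun r ↦ X r ω) (S t ω'))
          ∂P ∂P := by
        rw [hmap, lintegral_prod_symm _ hF.aemeasurable, lintegral_map hF.lintegral_prod_left' mS]
        refine lintegral_congr fun ω' ↦ ?_
        exact lintegral_map (hF.comp measurable_prodMk_right) mX
    _ = _ := by
        refine lintegral_congr fun ω' ↦ lintegral_congr_ae ?_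
        filter_upwards [hXc] with ω hω
        rw [pathEval_eq hω, pathEval_eq hω]

lemma integral_timeChange (hXm : ∀ t, Measurable (X t))
    (hXc : ∀ᵐ ω ∂P, Continuous fun t ↦ X t ω) (hS : ∀ t, Measurable (S t))
    (hind : IndepFun (fun ω t ↦ X t ω) (fun ω t ↦ S t ω) P) {g : ℝ × ℝ → ℝ}
    (hg : Measurable g) {s t : ℝ≥0}
    (hint : Integrable (fun ω ↦ g (timeChange X S s ω, timeChange X S t ω)) P) :
    ∫ ω, g (timeChange X S s ω, timeChange X S t ω) ∂P =
      ∫ ω', ∫ ω, g (X (S s ω') ω, X (S t ω') ω) ∂P ∂P := by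
  have mX : Measurable fun ω t ↦ X t ω := measurable_pi_lambda _ hXm
  have mS : Measurable fun ω t ↦ S t ω := measurable_pi_lambda _ hS
  have hF := measurable_pathEval_pair hg s t
  have hmap := (indepFun_iff_map_prod_eq_prod_map_map mX.aemeasurable mS.aemeasurable).1 hind
  have := Measure.isProbabilityMeasure_map (μ := P) mX.aemeasurable
  have := Measure.isProbabilityMeasure_map (μ := P) mS.aemeasurable
  have hae : (fun ω ↦ g (timeChange X S s ω, timeChange X S t ω)) =ᵐ[P]
      fun ω ↦ g (pathEval (fun r ↦ X r ω) (S s ω), pathEval (fun r ↦ X r ω) (S t ω)) := by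
    filter_upwards [timeChange_ae_eq_pathEval hXc s (S := S),
      timeChange_ae_eq_pathEval hXc t (S := S)] with ω h1 h2
    rw [h1, h2]
  have hintF : Integrable (fun x : (ℝ≥0 → ℝ) × (ℝ≥0 → ℝ≥0) ↦
      g (pathEval x.1 (x.2 s), pathEval x.1 (x.2 t)))
      (P.map fun ω ↦ (fun t ↦ X t ω, fun t ↦ S t ω)) := by
    rw [integrable_map_measure hF.aestronglyMeasurable (mX.prodMk mS).aemeasurable]
    exact hint.congr hae
  calc ∫ ω, g (timeChange X S s ω, timeChange X S t ω) ∂P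
      = ∫ x, g (pathEval x.1 (x.2 s), pathEval x.1 (x.2 t))
          ∂(P.map fun ω ↦ (fun t ↦ X t ω, fun t ↦ S t ω)) := by
        rw [integral_map (mX.prodMk mS).aemeasurable hF.aestronglyMeasurable]
        exact integral_congr_ae hae
    _ = ∫ ω', ∫ ω, g (pathEval (fun r ↦ X r ω) (S s ω'), pathEval (fun r ↦ X r ω) (S t ω'))
          ∂P ∂P := by
        rw [hmap] at hintF ⊢
        rw [integral_prod_symm _ hintF, integral_map mS.aemeasurable
          hF.stronglyMeasurable.integral_prod_left'.aestronglyMeasurable]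
        refine integral_congr_ae (.of_forall fun ω' ↦ ?_)
        exact integral_map mX.aemeasurable
          (hF.comp measurable_prodMk_right).aestronglyMeasurable
    _ = _ := by
        refine integral_congr_ae (.of_forall fun ω' ↦ integral_congr_ae ?_)
        filter_upwards [hXc] with ω hω
        rw [pathEval_eq hω, pathEval_eq hω]

lemma memLp_two_timeChange (hXm : ∀ t, Measurable (X t))
    (hXc : ∀ᵐ ω ∂P, Continuous fun t ↦ X t ω) (hS : ∀ t, Measurable (S t))
    (hind : IndepFun (fun ω t ↦ X t ω) (fun ω t ↦ S t ω) P) (hX2 : ∀ t, MemLp (X t) 2 P)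
    (t : ℝ≥0) (hint : Integrable (fun ω' ↦ ∫ ω, X (S t ω') ω ^ 2 ∂P) P) :
    MemLp (timeChange X S t) 2 P := by
  have hm := (aemeasurable_timeChange hXm hXc hS t).aestronglyMeasurable
  rw [memLp_two_iff_integrable_sq hm]
  refine ⟨hm.pow 2, ?_⟩
  rw [hasFiniteIntegral_iff_ofReal (.of_forall fun _ ↦ sq_nonneg _)]
  rw [lintegral_timeChange hXm hXc hS hind (g := fun x ↦ ENNReal.ofReal (x.1 ^ 2))
    (by fun_prop) t t]
  have h2 := (hasFiniteIntegral_iff_ofReal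
    (.of_forall fun _ ↦ integral_nonneg fun _ ↦ sq_nonneg _)).1 hint.2
  convert h2 using 3 with ω'
  exact (ofReal_integral_eq_lintegral_ofReal (hX2 _).integrable_sq
    (.of_forall fun _ ↦ sq_nonneg _)).symm

lemma integral_timeChange_eq_zero (hXm : ∀ t, Measurable (X t))
    (hXc : ∀ᵐ ω ∂P, Continuous fun t ↦ X t ω) (hS : ∀ t, Measurable (S t))
    (hind : IndepFun (fun ω t ↦ X t ω) (fun ω t ↦ S t ω) P)
    (hX0 : ∀ t, ∫ ω, X t ω ∂P = 0) (t : ℝ≥0) : ∫ ω, timeChange X S t ω ∂P = 0 := by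
  by_cases hint : Integrable (timeChange X S t) P
  · rw [integral_timeChange hXm hXc hS hind (g := Prod.fst) measurable_fst (s := t) (t := t) hint]
    simp [hX0]
  -- A non-integrable function has Bochner integral `0` by convention, so no integrability
  -- hypothesis is required.
  · exact integral_undef hint

end TimeChange

/-! ### Moments of the tempered stable law -/

/-- As `α < 1`, the term `t y ^ α` is eventually below `y / 2`, so the integrand is dominated by
`exp (-y / 2)`. -/
lemma integrableOn_exp_neg_add_mul_rpow {α t : ℝ} (hα₀ : 0 < α) (hα₁ : α < 1) :
    IntegrableOn (fun y : ℝ ↦ Real.exp (-y + t * y ^ α)) (Set.Ioi 0) := by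
  refine integrable_of_isBigO_exp_neg (b := 1 / 2) (by norm_num) ?_ ?_
  · have : Continuous fun y : ℝ ↦ y ^ α := Real.continuous_rpow_const hα₀.le
    fun_prop
  · refine IsBigO.of_bound 1 ?_
    have h1 : Tendsto (fun y : ℝ ↦ t * y ^ (-(1 - α))) atTop (𝓝 0) := by
      simpa using (tendsto_rpow_neg_atTop (y := 1 - α) (by linarith)).const_mul t
    filter_upwards [h1.eventually_lt_const (half_pos one_pos), eventually_gt_atTop 0] with y hy hy0
    rw [Real.norm_of_nonneg (Real.exp_pos _).le, Real.norm_of_nonneg (Real.exp_pos _).le, one_mul,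
      Real.exp_le_exp]
    have h2 : y ^ α = y ^ (-(1 - α)) * y := by
      rw [← Real.rpow_add_one hy0.ne']; congr 1; ring
    rw [h2]
    nlinarith

lemma exists_abs_stableDensity_le {α t : ℝ} (hα₀ : 0 < α) (hα₁ : α < 1) (ht : 0 ≤ t) :
    ∃ C : ℝ, ∀ x, 1 ≤ x → |stableDensity α x t| ≤ C := by
  refine ⟨1 / Real.pi * ∫ y in Set.Ioi (0 : ℝ), Real.exp (-y + t * y ^ α), fun x hx ↦ ?_⟩
  rw [stableDensity, abs_mul, abs_of_nonneg (by positivity)]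
  gcongr
  rw [← Real.norm_eq_abs]
  refine norm_integral_le_of_norm_le (integrableOn_exp_neg_add_mul_rpow hα₀ hα₁) ?_
  filter_upwards [ae_restrict_mem measurableSet_Ioi] with y hy
  have hy0 : (0 : ℝ) < y := hy
  rw [← Real.exp_add, norm_mul, Real.norm_of_nonneg (Real.exp_pos _).le, Real.norm_eq_abs]
  have hp : 0 ≤ t * y ^ α := by positivity
  calc Real.exp (-(x * y) + -(t * y ^ α * Real.cos (α * Real.pi))) *
        |Real.sin (t * y ^ α * Real.sin (α * Real.pi))|
      ≤ Real.exp (-y + t * y ^ α) * 1 := by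
        gcongr
        · nlinarith
        · have := Real.neg_one_le_cos (α * Real.pi)
          nlinarith
        · exact Real.abs_sin_le_one _
    _ = _ := mul_one _

lemma ae_pos_temperedStableLaw (lam α t : ℝ) : ∀ᵐ x ∂temperedStableLaw lam α t, 0 < x :=
  (withDensity_absolutelyContinuous _ _).ae_le (ae_restrict_mem measurableSet_Ioi)

/-- Tempering enters here: on `(1, ∞)` the stable density is bounded and the factor `exp (-lam x)`
supplies the second moment. On `(0, 1]` the integrand is at most `1`, so finiteness of the measure
replaces any estimate of the density near `0`. -/
lemma integrable_sq_temperedStableLaw {lam α t : ℝ} (hlam : 0 < lam) (hα₀ : 0 < α) (hα₁ : α < 1)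
    (ht : 0 ≤ t) [IsFiniteMeasure (temperedStableLaw lam α t)] :
    Integrable (fun x ↦ x ^ 2) (temperedStableLaw lam α t) := by
  obtain ⟨C, hC⟩ := exists_abs_stableDensity_le (t := t) hα₀ hα₁ ht
  have hIic : IntegrableOn (fun x : ℝ ↦ x ^ 2) (Set.Iic 1) (temperedStableLaw lam α t) := by
    refine Measure.integrableOn_of_bounded (M := 1) (measure_ne_top _ _)
      (by fun_prop) ?_
    filter_upwards [ae_restrict_mem measurableSet_Iic,
      ae_restrict_of_ae (ae_pos_temperedStableLaw lam α t)] with x hx hx0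
    have hx1 : x ≤ 1 := hx
    rw [Real.norm_of_nonneg (sq_nonneg x)]
    nlinarith
  have hIoi : IntegrableOn (fun x : ℝ ↦ x ^ 2) (Set.Ioi 1) (temperedStableLaw lam α t) := by
    have hle : (temperedStableLaw lam α t).restrict (Set.Ioi 1) ≤
        (volume.restrict (Set.Ioi (1 : ℝ))).withDensity
          fun x ↦ ENNReal.ofReal (Real.exp (-(lam * x) + lam ^ α * t) * C) := by
      rw [temperedStableLaw, restrict_withDensity measurableSet_Ioi,
        Measure.restrict_restrict measurableSet_Ioi, Set.Ioi_inter_Ioi,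
        sup_of_le_left zero_le_one]
      refine withDensity_mono ?_
      filter_upwards [ae_restrict_mem measurableSet_Ioi] with x hx
      refine ENNReal.ofReal_le_ofReal ?_
      rw [temperedStableDensity]
      gcongr
      exact (le_abs_self _).trans (hC x (le_of_lt hx))
    refine Integrable.mono_measure ?_ hle
    rw [integrable_withDensity_iff (by fun_prop) (.of_forall fun _ ↦ ENNReal.ofReal_lt_top)]
    have hC0 : 0 ≤ C := (abs_nonneg _).trans (hC 1 le_rfl)
    have h1 : IntegrableOn (fun x : ℝ ↦ x ^ (2 : ℝ) * Real.exp (-lam * x ^ (1 : ℝ)))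
        (Set.Ioi 0) := integrableOn_rpow_mul_exp_neg_mul_rpow (by norm_num) one_pos hlam
    have h2 := (h1.mono_set (Set.Ioi_subset_Ioi zero_le_one)).const_mul
      (Real.exp (lam ^ α * t) * C)
    refine h2.congr (.of_forall fun x ↦ ?_)
    dsimp only
    rw [ENNReal.toReal_ofReal (mul_nonneg (Real.exp_pos _).le hC0), Real.exp_add, Real.rpow_one,
      Real.rpow_two, neg_mul]
    ring
  have := hIic.union hIoi
  rwa [Set.Iic_union_Ioi, integrableOn_univ] at this

/-- The `q`-th moment of the tempered stable law at time `t`. -/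
noncomputable def temperedStableMoment (lam α q t : ℝ) : ℝ :=
  ∫ x, x ^ q ∂temperedStableLaw lam α t

/-- The law is carried by `(0, ∞)`, where `x ^ q` never vanishes; a zero moment would force the
measure to be zero. -/
lemma temperedStableMoment_pos {lam α q t : ℝ} (hlam : 0 < lam) (hα₀ : 0 < α) (hα₁ : α < 1)
    (ht : 0 ≤ t) [IsProbabilityMeasure (temperedStableLaw lam α t)] (hq0 : 0 ≤ q) (hq2 : q ≤ 2) :
    0 < temperedStableMoment lam α q t := by
  have hpos := ae_pos_temperedStableLaw lam α t
  have hint : Integrable (fun x : ℝ ↦ x ^ q) (temperedStableLaw lam α t) := by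
    refine ((integrable_const (1 : ℝ)).add
      (integrable_sq_temperedStableLaw hlam hα₀ hα₁ ht)).mono' (by fun_prop) ?_
    filter_upwards [hpos] with x hx
    rw [Real.norm_of_nonneg (Real.rpow_nonneg hx.le q)]
    simp only [Pi.add_apply]
    rcases le_total x 1 with h1 | h1
    · have := Real.rpow_le_one hx.le h1 hq0
      nlinarith [sq_nonneg x]
    · have := Real.rpow_le_rpow_of_exponent_le h1 hq2
      rw [Real.rpow_two] at this
      linarith
  have hnn : 0 ≤ᵐ[temperedStableLaw lam α t] fun x ↦ x ^ q := by
    filter_upwards [hpos] with x hx using Real.rpow_nonneg hx.le q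
  refine lt_of_le_of_ne (integral_nonneg_of_ae hnn) fun h0 ↦ ?_
  have := (integral_eq_zero_iff_of_nonneg_ae hnn hint).1 h0.symm
  have hF : ∀ᵐ _ ∂temperedStableLaw lam α t, False := by
    filter_upwards [hpos, this] with x hx h
    exact (Real.rpow_pos_of_pos hx q).ne' h
  simp only [eventually_false_iff_eq_bot, ae_eq_bot] at hF
  exact IsProbabilityMeasure.ne_zero _ hF

namespace IsTemperedStableSubordinator

variable {Ω : Type*} [MeasurableSpace Ω] {P : Measure Ω} {lam α : ℝ} {S : ℝ≥0 → Ω → ℝ≥0}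

lemma isProbabilityMeasure_law [IsProbabilityMeasure P]
    (h : IsTemperedStableSubordinator lam α S P) {t : ℝ≥0} (ht : 0 < t) :
    IsProbabilityMeasure (temperedStableLaw lam α t) :=
  (h.law t ht).isProbabilityMeasure_iff.1 inferInstance

lemma isSqIntegrableSubordinator [IsProbabilityMeasure P]
    (h : IsTemperedStableSubordinator lam α S P) (hlam : 0 < lam) (hα₀ : 0 < α) (hα₁ : α < 1) :
    IsSqIntegrableSubordinator (fun t ω ↦ (S t ω : ℝ)) P where
  measurable t := (h.measurable t).coe_nnreal_real
  nonneg t ω := (S t ω).coe_nonneg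
  start_zero := by filter_upwards [h.start_zero] with ω hω using by simp [hω]
  mono s t hst := by filter_upwards [h.monotone_paths] with ω hω using NNReal.coe_le_coe.2 (hω hst)
  indep := h.indep_increments
  stationary := h.stationary_increments
  memLp t := by
    rcases eq_zero_or_pos t with rfl | ht
    · refine MemLp.ae_eq (f := fun _ ↦ (0 : ℝ)) ?_ MemLp.zero'
      filter_upwards [h.start_zero] with ω hω using by simp [hω]
    · have := h.isProbabilityMeasure_law ht
      rw [memLp_two_iff_integrable_sq (h.measurable t).coe_nnreal_real.aestronglyMeasurable]
      have hi := integrable_sq_temperedStableLaw (t := t) hlam hα₀ hα₁ t.2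
      rw [← (h.law t ht).map_eq] at hi
      exact hi.comp_aemeasurable (h.law t ht).aemeasurable

lemma integral_rpow (h : IsTemperedStableSubordinator lam α S P) {t : ℝ≥0} (ht : 0 < t) (q : ℝ) :
    ∫ ω, (S t ω : ℝ) ^ q ∂P = temperedStableMoment lam α q t :=
  (h.law t ht).integral_comp (f := fun x : ℝ ↦ x ^ q) (by fun_prop)

end IsTemperedStableSubordinator

/-! ### Covariance of the time-changed mixed process -/

section TimeChangedMixed

variable {Ω : Type*} [MeasurableSpace Ω] {P : Measure Ω}
  {H₁ H₂ a b : ℝ} {B₁ B₂ : ℝ≥0 → Ω → ℝ} {S : ℝ≥0 → Ω → ℝ≥0}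

lemma IsFractionalBrownianMotion.memLp_two {H : ℝ} {B : ℝ≥0 → Ω → ℝ}
    (h : IsFractionalBrownianMotion H B P) (t : ℝ≥0) : MemLp (B t) 2 P :=
  (h.gaussian.hasGaussianLaw_eval t).memLp_two

lemma measurable_gmfbm (h₁ : IsFractionalBrownianMotion H₁ B₁ P)
    (h₂ : IsFractionalBrownianMotion H₂ B₂ P) (t : ℝ≥0) : Measurable (gmfbm a b B₁ B₂ t) :=
  ((h₁.measurable t).const_mul a).add ((h₂.measurable t).const_mul b)

lemma continuous_gmfbm (h₁ : IsFractionalBrownianMotion H₁ B₁ P)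
    (h₂ : IsFractionalBrownianMotion H₂ B₂ P) :
    ∀ᵐ ω ∂P, Continuous fun t ↦ gmfbm a b B₁ B₂ t ω := by
  filter_upwards [h₁.continuous_paths, h₂.continuous_paths] with ω c₁ c₂
  exact (c₁.const_mul a).add (c₂.const_mul b)

lemma memLp_gmfbm (h₁ : IsFractionalBrownianMotion H₁ B₁ P)
    (h₂ : IsFractionalBrownianMotion H₂ B₂ P) (t : ℝ≥0) : MemLp (gmfbm a b B₁ B₂ t) 2 P :=
  ((h₁.memLp_two t).const_mul a).add ((h₂.memLp_two t).const_mul b)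

lemma integral_gmfbm_mul (h₁ : IsFractionalBrownianMotion H₁ B₁ P)
    (h₂ : IsFractionalBrownianMotion H₂ B₂ P)
    (hB : IndepFun (fun ω t ↦ B₁ t ω) (fun ω t ↦ B₂ t ω) P) (s t : ℝ≥0) :
    ∫ ω, gmfbm a b B₁ B₂ s ω * gmfbm a b B₁ B₂ t ω ∂P =
      a ^ 2 / 2 * ((s : ℝ) ^ (2 * H₁) + (t : ℝ) ^ (2 * H₁) - |(s : ℝ) - t| ^ (2 * H₁)) +
      b ^ 2 / 2 * ((s : ℝ) ^ (2 * H₂) + (t : ℝ) ^ (2 * H₂) - |(s : ℝ) - t| ^ (2 * H₂)) := by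
  have i₁₁ : Integrable (fun ω ↦ B₁ s ω * B₁ t ω) P :=
    (h₁.memLp_two s).integrable_mul (h₁.memLp_two t)
  have i₂₂ : Integrable (fun ω ↦ B₂ s ω * B₂ t ω) P :=
    (h₂.memLp_two s).integrable_mul (h₂.memLp_two t)
  have i₁₂ : ∀ s t, Integrable (fun ω ↦ B₁ s ω * B₂ t ω) P := fun s t ↦
    (h₁.memLp_two s).integrable_mul (h₂.memLp_two t)
  -- Independence and centring kill the cross terms, so the two components contribute separately.
  have e₁₂ : ∀ s t, ∫ ω, B₁ s ω * B₂ t ω ∂P = 0 := fun s t ↦ by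
    have hi : IndepFun (B₁ s) (B₂ t) P :=
      hB.comp (measurable_pi_apply s) (measurable_pi_apply t)
    rw [hi.integral_fun_mul_eq_mul_integral (h₁.memLp_two s).aestronglyMeasurable
      (h₂.memLp_two t).aestronglyMeasurable, h₁.centred, zero_mul]
  have e : ∀ ω, gmfbm a b B₁ B₂ s ω * gmfbm a b B₁ B₂ t ω =
      (a ^ 2 * (B₁ s ω * B₁ t ω) + b ^ 2 * (B₂ s ω * B₂ t ω)) +
      ((a * b) * (B₁ s ω * B₂ t ω) + (a * b) * (B₁ t ω * B₂ s ω)) := fun ω ↦ by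
    unfold gmfbm; ring
  simp_rw [e]
  have j₁ : Integrable
      (fun ω ↦ a ^ 2 * (B₁ s ω * B₁ t ω) + b ^ 2 * (B₂ s ω * B₂ t ω)) P :=
    (i₁₁.const_mul _).add (i₂₂.const_mul _)
  have j₂ : Integrable
      (fun ω ↦ (a * b) * (B₁ s ω * B₂ t ω) + (a * b) * (B₁ t ω * B₂ s ω)) P :=
    ((i₁₂ s t).const_mul _).add ((i₁₂ t s).const_mul _)
  rw [integral_add j₁ j₂, integral_add (i₁₁.const_mul _) (i₂₂.const_mul _),
    integral_add ((i₁₂ s t).const_mul _) ((i₁₂ t s).const_mul _)]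
  simp_rw [integral_const_mul]
  rw [e₁₂, e₁₂, h₁.covariance, h₂.covariance]
  ring

lemma integral_gmfbm_sq (hH₁ : 0 < H₁) (hH₂ : 0 < H₂) (h₁ : IsFractionalBrownianMotion H₁ B₁ P)
    (h₂ : IsFractionalBrownianMotion H₂ B₂ P)
    (hB : IndepFun (fun ω t ↦ B₁ t ω) (fun ω t ↦ B₂ t ω) P) (t : ℝ≥0) :
    ∫ ω, gmfbm a b B₁ B₂ t ω ^ 2 ∂P =
      a ^ 2 * (t : ℝ) ^ (2 * H₁) + b ^ 2 * (t : ℝ) ^ (2 * H₂) := by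
  simp_rw [sq (gmfbm a b B₁ B₂ t _)]
  rw [integral_gmfbm_mul h₁ h₂ hB, sub_self, abs_zero, Real.zero_rpow (by positivity),
    Real.zero_rpow (by positivity)]
  ring

lemma indepFun_gmfbm (hBS : IndepFun (fun ω ↦ ((fun t ↦ B₁ t ω), (fun t ↦ B₂ t ω)))
    (fun ω t ↦ S t ω) P) :
    IndepFun (fun ω t ↦ gmfbm a b B₁ B₂ t ω) (fun ω t ↦ S t ω) P := by
  have hφ : Measurable fun (p : (ℝ≥0 → ℝ) × (ℝ≥0 → ℝ)) (t : ℝ≥0) ↦ a * p.1 t + b * p.2 t :=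
    measurable_pi_lambda _ fun t ↦ by fun_prop
  exact hBS.comp hφ measurable_id

variable [IsProbabilityMeasure P]

lemma integral_gmfbm (h₁ : IsFractionalBrownianMotion H₁ B₁ P)
    (h₂ : IsFractionalBrownianMotion H₂ B₂ P) (t : ℝ≥0) :
    ∫ ω, gmfbm a b B₁ B₂ t ω ∂P = 0 := by
  have i₁ := ((h₁.memLp_two t).integrable one_le_two).const_mul a
  have i₂ := ((h₂.memLp_two t).integrable one_le_two).const_mul b
  unfold gmfbm
  rw [integral_add i₁ i₂, integral_const_mul, integral_const_mul, h₁.centred, h₂.centred]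
  simp

lemma memLp_timeChange_gmfbm (hH₁ : 0 < H₁) (hH₁' : H₁ ≤ 1) (hH₂ : 0 < H₂) (hH₂' : H₂ ≤ 1)
    (h₁ : IsFractionalBrownianMotion H₁ B₁ P) (h₂ : IsFractionalBrownianMotion H₂ B₂ P)
    (hB : IndepFun (fun ω t ↦ B₁ t ω) (fun ω t ↦ B₂ t ω) P) (hS : ∀ t, Measurable (S t))
    (hT : IsSqIntegrableSubordinator (fun t ω ↦ (S t ω : ℝ)) P)
    (hBS : IndepFun (fun ω ↦ ((fun t ↦ B₁ t ω), (fun t ↦ B₂ t ω))) (fun ω t ↦ S t ω) P)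
    (t : ℝ≥0) : MemLp (timeChange (gmfbm a b B₁ B₂) S t) 2 P := by
  refine memLp_two_timeChange (measurable_gmfbm h₁ h₂) (continuous_gmfbm h₁ h₂) hS
    (indepFun_gmfbm hBS) (memLp_gmfbm h₁ h₂) t ?_
  simp_rw [integral_gmfbm_sq hH₁ hH₂ h₁ h₂ hB]
  exact ((hT.integrable_rpow t (q := 2 * H₁) (by positivity) (by linarith)).const_mul _).add
    ((hT.integrable_rpow t (q := 2 * H₂) (by positivity) (by linarith)).const_mul _)

lemma integral_timeChange_gmfbm (h₁ : IsFractionalBrownianMotion H₁ B₁ P)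
    (h₂ : IsFractionalBrownianMotion H₂ B₂ P) (hS : ∀ t, Measurable (S t))
    (hBS : IndepFun (fun ω ↦ ((fun t ↦ B₁ t ω), (fun t ↦ B₂ t ω))) (fun ω t ↦ S t ω) P)
    (t : ℝ≥0) : ∫ ω, timeChange (gmfbm a b B₁ B₂) S t ω ∂P = 0 :=
  integral_timeChange_eq_zero (measurable_gmfbm h₁ h₂) (continuous_gmfbm h₁ h₂) hS
    (indepFun_gmfbm hBS) (integral_gmfbm h₁ h₂) t

lemma variance_timeChange_gmfbm (hH₁ : 0 < H₁) (hH₁' : H₁ ≤ 1) (hH₂ : 0 < H₂) (hH₂' : H₂ ≤ 1)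
    (h₁ : IsFractionalBrownianMotion H₁ B₁ P) (h₂ : IsFractionalBrownianMotion H₂ B₂ P)
    (hB : IndepFun (fun ω t ↦ B₁ t ω) (fun ω t ↦ B₂ t ω) P) (hS : ∀ t, Measurable (S t))
    (hT : IsSqIntegrableSubordinator (fun t ω ↦ (S t ω : ℝ)) P)
    (hBS : IndepFun (fun ω ↦ ((fun t ↦ B₁ t ω), (fun t ↦ B₂ t ω))) (fun ω t ↦ S t ω) P)
    (t : ℝ≥0) : Var[timeChange (gmfbm a b B₁ B₂) S t; P] =
      a ^ 2 * (∫ ω, (S t ω : ℝ) ^ (2 * H₁) ∂P) + b ^ 2 * ∫ ω, (S t ω : ℝ) ^ (2 * H₂) ∂P := by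
  have hm := memLp_timeChange_gmfbm (a := a) (b := b) hH₁ hH₁' hH₂ hH₂' h₁ h₂ hB hS hT hBS t
  rw [variance_of_integral_eq_zero hm.aestronglyMeasurable.aemeasurable
    (integral_timeChange_gmfbm h₁ h₂ hS hBS t),
    integral_timeChange (measurable_gmfbm h₁ h₂) (continuous_gmfbm h₁ h₂) hS
      (indepFun_gmfbm hBS) (g := fun x ↦ x.1 ^ 2) (by fun_prop) (s := t) (t := t)
      hm.integrable_sq]
  simp_rw [integral_gmfbm_sq hH₁ hH₂ h₁ h₂ hB]
  rw [integral_add ((hT.integrable_rpow t (q := 2 * H₁) (by positivity) (by linarith)).const_mul _)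
    ((hT.integrable_rpow t (q := 2 * H₂) (by positivity) (by linarith)).const_mul _),
    integral_const_mul, integral_const_mul]

/-- Freezing the clock leaves the fractional covariance at `S_{s+u}` and `S_s`; stationarity turns
the mean power of the increment into a moment of `S_u`. Only one-dimensional moments of `S` remain.
-/
lemma covariance_timeChange_gmfbm (hH₁ : 0 < H₁) (hH₁' : H₁ ≤ 1) (hH₂ : 0 < H₂) (hH₂' : H₂ ≤ 1)
    (h₁ : IsFractionalBrownianMotion H₁ B₁ P) (h₂ : IsFractionalBrownianMotion H₂ B₂ P)
    (hB : IndepFun (fun ω t ↦ B₁ t ω) (fun ω t ↦ B₂ t ω) P) (hS : ∀ t, Measurable (S t))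
    (hT : IsSqIntegrableSubordinator (fun t ω ↦ (S t ω : ℝ)) P)
    (hBS : IndepFun (fun ω ↦ ((fun t ↦ B₁ t ω), (fun t ↦ B₂ t ω))) (fun ω t ↦ S t ω) P)
    (s u : ℝ≥0) :
    cov[timeChange (gmfbm a b B₁ B₂) S (s + u), timeChange (gmfbm a b B₁ B₂) S s; P] =
      a ^ 2 / 2 * ((∫ ω, (S (s + u) ω : ℝ) ^ (2 * H₁) ∂P) +
        (∫ ω, (S s ω : ℝ) ^ (2 * H₁) ∂P) - ∫ ω, (S u ω : ℝ) ^ (2 * H₁) ∂P) +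
      b ^ 2 / 2 * ((∫ ω, (S (s + u) ω : ℝ) ^ (2 * H₂) ∂P) +
        (∫ ω, (S s ω : ℝ) ^ (2 * H₂) ∂P) - ∫ ω, (S u ω : ℝ) ^ (2 * H₂) ∂P) := by
  have hm := memLp_timeChange_gmfbm (a := a) (b := b) hH₁ hH₁' hH₂ hH₂' h₁ h₂ hB hS hT hBS
  rw [covariance_eq_sub (hm _) (hm _), integral_timeChange_gmfbm h₁ h₂ hS hBS, zero_mul, sub_zero]
  have hprod : Integrable (fun ω ↦ timeChange (gmfbm a b B₁ B₂) S (s + u) ω *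
      timeChange (gmfbm a b B₁ B₂) S s ω) P := (hm _).integrable_mul (hm _)
  have e := integral_timeChange (measurable_gmfbm h₁ h₂) (continuous_gmfbm h₁ h₂) hS
      (indepFun_gmfbm hBS) (g := fun x ↦ x.1 * x.2) (by fun_prop) (s := s + u) (t := s) hprod
  simp_rw [integral_gmfbm_mul h₁ h₂ hB] at e
  simp only [Pi.mul_apply]
  rw [e]
  have j : ∀ H : ℝ, 0 < H → H ≤ 1 → ∀ t, Integrable (fun ω ↦ (S t ω : ℝ) ^ (2 * H)) P :=
    fun H h0 h1 t ↦ hT.integrable_rpow t (q := 2 * H) (by positivity) (by linarith)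
  have jadd : ∀ H : ℝ, 0 < H → H ≤ 1 →
      Integrable (fun ω ↦ (S (s + u) ω : ℝ) ^ (2 * H) + (S s ω : ℝ) ^ (2 * H)) P :=
    fun H h0 h1 ↦ (j H h0 h1 _).add (j H h0 h1 _)
  have jsub : ∀ H : ℝ, 0 < H → H ≤ 1 →
      Integrable (fun ω ↦ |(S (s + u) ω : ℝ) - S s ω| ^ (2 * H)) P :=
    fun H h0 h1 ↦ hT.integrable_rpow_sub s u (q := 2 * H) (by positivity) (by linarith)
  have iH : ∀ H : ℝ, 0 < H → H ≤ 1 → Integrable (fun ω ↦ (S (s + u) ω : ℝ) ^ (2 * H) +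
      (S s ω : ℝ) ^ (2 * H) - |(S (s + u) ω : ℝ) - S s ω| ^ (2 * H)) P :=
    fun H h0 h1 ↦ (jadd H h0 h1).sub (jsub H h0 h1)
  have eH : ∀ H : ℝ, 0 < H → H ≤ 1 → ∫ ω, ((S (s + u) ω : ℝ) ^ (2 * H) +
      (S s ω : ℝ) ^ (2 * H) - |(S (s + u) ω : ℝ) - S s ω| ^ (2 * H)) ∂P =
      (∫ ω, (S (s + u) ω : ℝ) ^ (2 * H) ∂P) + (∫ ω, (S s ω : ℝ) ^ (2 * H) ∂P) -
        ∫ ω, (S u ω : ℝ) ^ (2 * H) ∂P := fun H h0 h1 ↦ by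
    rw [integral_sub (jadd H h0 h1) (jsub H h0 h1), integral_add (j H h0 h1 _) (j H h0 h1 _),
      hT.integral_rpow_sub_eq s u]
  rw [integral_add ((iH H₁ hH₁ hH₁').const_mul _) ((iH H₂ hH₂ hH₂').const_mul _),
    integral_const_mul, integral_const_mul, eH H₁ hH₁ hH₁', eH H₂ hH₂ hH₂']

end TimeChangedMixed

/-! ### Power asymptotics -/

lemma tendsto_nnreal_coe_atTop : Tendsto (fun t : ℝ≥0 ↦ (t : ℝ)) atTop atTop :=
  NNReal.tendsto_coe_atTop.2 tendsto_id

/-- Replacing `t - s` by `t` in the normalisation costs the factor `(1 - s/t) ^ e`, which tends to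
`1`. -/
lemma tendsto_tsub_div_rpow {f : ℝ≥0 → ℝ} {e l : ℝ} (s : ℝ≥0)
    (h : Tendsto (fun u : ℝ≥0 ↦ f u / (u : ℝ) ^ e) atTop (𝓝 l)) :
    Tendsto (fun t : ℝ≥0 ↦ f (t - s) / (t : ℝ) ^ e) atTop (𝓝 l) := by
  have hsub : Tendsto (fun t : ℝ≥0 ↦ t - s) atTop atTop := by
    refine tendsto_atTop.2 fun b ↦ ?_
    filter_upwards [eventually_ge_atTop (b + s)] with t ht using le_tsub_of_add_le_right ht
  have h1 : Tendsto (fun t : ℝ≥0 ↦ 1 - (s : ℝ) * (t : ℝ)⁻¹) atTop (𝓝 1) := by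
    simpa using ((tendsto_inv_atTop_zero.comp tendsto_nnreal_coe_atTop).const_mul
      (s : ℝ)).const_sub 1
  have h2 := h1.rpow_const (p := e) (Or.inl one_ne_zero)
  have h3 := (h.comp hsub).mul h2
  rw [Real.one_rpow, mul_one] at h3
  refine h3.congr' ?_
  filter_upwards [eventually_gt_atTop s] with t ht
  have hs : (s : ℝ) < t := ht
  have ht0 : (0 : ℝ) < t := s.coe_nonneg.trans_lt hs
  have e1 : ((t - s : ℝ≥0) : ℝ) = t - s := NNReal.coe_sub ht.le
  have e2 : 1 - (s : ℝ) * (t : ℝ)⁻¹ = (t - s) / t := by field_simp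
  have hp : 0 < (t : ℝ) - s := sub_pos.2 hs
  have hpe := Real.rpow_pos_of_pos hp e
  simp only [Function.comp_apply]
  rw [e1, e2, Real.div_rpow hp.le ht0.le]
  field_simp

/-- The leading coefficient of `a² f₁ + b² f₂` when `fᵢ(t) ∼ lᵢ t ^ eᵢ` and `e₁ ≤ e₂`. -/
noncomputable def mixedCoeff (a b e₁ e₂ l₁ l₂ : ℝ) : ℝ :=
  if b = 0 then a ^ 2 * l₁ else (if e₁ = e₂ then a ^ 2 * l₁ else 0) + b ^ 2 * l₂

lemma mixedCoeff_pos {a b e₁ e₂ l₁ l₂ : ℝ} (hab : ¬(a = 0 ∧ b = 0)) (h₁ : 0 < l₁)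
    (h₂ : 0 < l₂) : 0 < mixedCoeff a b e₁ e₂ l₁ l₂ := by
  unfold mixedCoeff
  split_ifs with hb he
  · have : a ≠ 0 := fun ha ↦ hab ⟨ha, hb⟩
    positivity
  · positivity
  · positivity

lemma tendsto_add_div_rpow {f₁ f₂ : ℝ≥0 → ℝ} {e₁ e₂ l₁ l₂ : ℝ} (he : e₁ ≤ e₂)
    (h₁ : Tendsto (fun t : ℝ≥0 ↦ f₁ t / (t : ℝ) ^ e₁) atTop (𝓝 l₁))
    (h₂ : Tendsto (fun t : ℝ≥0 ↦ f₂ t / (t : ℝ) ^ e₂) atTop (𝓝 l₂)) :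
    Tendsto (fun t : ℝ≥0 ↦ (f₁ t + f₂ t) / (t : ℝ) ^ e₂) atTop
      (𝓝 ((if e₁ = e₂ then l₁ else 0) + l₂)) := by
  simp_rw [add_div]
  refine Tendsto.add ?_ h₂
  split_ifs with h
  · rwa [← h]
  · have hlt : e₁ < e₂ := lt_of_le_of_ne he h
    have := h₁.mul ((tendsto_rpow_neg_atTop (sub_pos.2 hlt)).comp tendsto_nnreal_coe_atTop)
    rw [mul_zero] at this
    refine this.congr' ?_
    filter_upwards [eventually_gt_atTop 0] with t ht
    have ht0 : (0 : ℝ) < t := ht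
    simp only [Function.comp_apply]
    rw [neg_sub, Real.rpow_sub ht0]
    have := Real.rpow_pos_of_pos ht0 e₁
    field_simp

lemma tendsto_mixed_div_rpow {f₁ f₂ : ℝ≥0 → ℝ} {e₁ e₂ l₁ l₂ : ℝ} (a b : ℝ) (he : e₁ ≤ e₂)
    (h₁ : Tendsto (fun t : ℝ≥0 ↦ f₁ t / (t : ℝ) ^ e₁) atTop (𝓝 l₁))
    (h₂ : Tendsto (fun t : ℝ≥0 ↦ f₂ t / (t : ℝ) ^ e₂) atTop (𝓝 l₂)) :
    Tendsto (fun t : ℝ≥0 ↦ (a ^ 2 * f₁ t + b ^ 2 * f₂ t) / (t : ℝ) ^ (if b = 0 then e₁ else e₂))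
      atTop (𝓝 (mixedCoeff a b e₁ e₂ l₁ l₂)) := by
  have h₁' : Tendsto (fun t : ℝ≥0 ↦ a ^ 2 * f₁ t / (t : ℝ) ^ e₁) atTop (𝓝 (a ^ 2 * l₁)) := by
    simpa only [mul_div_assoc] using h₁.const_mul (a ^ 2)
  have h₂' : Tendsto (fun t : ℝ≥0 ↦ b ^ 2 * f₂ t / (t : ℝ) ^ e₂) atTop (𝓝 (b ^ 2 * l₂)) := by
    simpa only [mul_div_assoc] using h₂.const_mul (b ^ 2)
  unfold mixedCoeff
  by_cases hb : b = 0
  · simpa [hb] using h₁'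
  · simpa only [if_neg hb] using tendsto_add_div_rpow he h₁' h₂'

lemma tendsto_ratio_div_rpow {C V : ℝ≥0 → ℝ} {e h κ v : ℝ} (w : ℝ) (hv : 0 < v)
    (hC : Tendsto (fun t : ℝ≥0 ↦ C t / (t : ℝ) ^ e) atTop (𝓝 κ))
    (hV : Tendsto (fun t : ℝ≥0 ↦ V t / (t : ℝ) ^ (2 * h)) atTop (𝓝 v)) :
    Tendsto (fun t : ℝ≥0 ↦ C t / (√(V t) * w) / (t : ℝ) ^ (e - h)) atTop
      (𝓝 (κ / (√v * w))) := by
  have hs : Tendsto (fun t : ℝ≥0 ↦ √(V t / (t : ℝ) ^ (2 * h))) atTop (𝓝 √v) :=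
    (Real.continuous_sqrt.tendsto v).comp hV
  have := (hC.div hs (Real.sqrt_pos.2 hv).ne').div_const w
  rw [div_div] at this
  refine this.congr' ?_
  filter_upwards [eventually_gt_atTop 0] with t ht
  have ht0 : (0 : ℝ) < t := ht
  have e1 : √(V t / (t : ℝ) ^ (2 * h)) = √(V t) / (t : ℝ) ^ h := by
    rw [Real.sqrt_div' _ (Real.rpow_nonneg ht0.le _), mul_comm, Real.rpow_mul ht0.le,
      Real.rpow_two, Real.sqrt_sq (Real.rpow_nonneg ht0.le _)]
  simp only [Pi.div_apply]
  rw [e1, Real.rpow_sub ht0]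
  have h1 := Real.rpow_pos_of_pos ht0 e
  have h2 := Real.rpow_pos_of_pos ht0 h
  simp only [div_eq_mul_inv, mul_inv, inv_inv]
  ring

lemma isEquivalent_const_mul_rpow {f : ℝ≥0 → ℝ} {c d : ℝ} (hc : c ≠ 0)
    (h : Tendsto (fun t : ℝ≥0 ↦ f t / (t : ℝ) ^ d) atTop (𝓝 c)) :
    f ~[atTop] fun t : ℝ≥0 ↦ c * (t : ℝ) ^ d := by
  refine isEquivalent_of_tendsto_one ?_
  have := h.div_const c
  rw [div_self hc] at this
  refine this.congr fun t ↦ ?_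
  simp only [Pi.div_apply]
  rw [div_div, mul_comm c]

lemma const_mul_rpow_add_isEquivalent {c c' d d' : ℝ} (hc : c ≠ 0) (hd : d' < d) :
    (fun t : ℝ≥0 ↦ c' * (t : ℝ) ^ d' + c * (t : ℝ) ^ d) ~[atTop]
      fun t : ℝ≥0 ↦ c * (t : ℝ) ^ d := by
  have hconst : ∀ x y : ℝ, Tendsto (fun t : ℝ≥0 ↦ x * (t : ℝ) ^ y / (t : ℝ) ^ y) atTop (𝓝 x) :=
    fun x y ↦ tendsto_const_nhds.congr' (by
      filter_upwards [eventually_gt_atTop 0] with t ht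
      have ht0 : (0 : ℝ) < t := ht
      rw [mul_div_cancel_right₀ _ (Real.rpow_pos_of_pos ht0 y).ne'])
  have := tendsto_add_div_rpow hd.le (hconst c' d') (hconst c d)
  rw [if_neg hd.ne, zero_add] at this
  exact isEquivalent_const_mul_rpow hc this

/-! ### Asymptotics of the moments entering the covariance -/

/-- The limit of `(m(s + u) + m(s) - m(u)) / u ^ max (q - 1) 0` as `u → ∞`, where `m(t)` is the
`q`-th moment at time `t` of a subordinator with mean `μ` at time `1`, and `m = m(s)`. -/
noncomputable def incrementCoeff (q s μ m : ℝ) : ℝ :=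
  if q < 1 then m else if q = 1 then 2 * s * μ else q * s * μ ^ q

lemma incrementCoeff_pos {q s μ m : ℝ} (hs : 0 < s) (hμ : 0 < μ) (hm : 0 < m) :
    0 < incrementCoeff q s μ m := by
  unfold incrementCoeff
  split_ifs with h1 h2
  · exact hm
  · positivity
  · have : 0 < q := by linarith [not_lt.1 h1]
    positivity

/-- Needed for the positivity of the second constant in the two-term asymptotics when `H₁ = H₂`,
where the first constant is subtracted from the total. -/
lemma mul_rpow_le_incrementCoeff {q s μ m : ℝ} (hs : 0 < s) (hμ : 0 < μ) (hq : 1 ≤ q) :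
    q * s * μ ^ q ≤ incrementCoeff q s μ m := by
  unfold incrementCoeff
  rw [if_neg (not_lt.2 hq)]
  split_ifs with h
  · subst h
    rw [Real.rpow_one]
    nlinarith [mul_pos hs hμ]
  · exact le_rfl

lemma IsSqIntegrableSubordinator.tendsto_incrementCoeff {Ω : Type*} [MeasurableSpace Ω]
    {P : Measure Ω} [IsProbabilityMeasure P] {T : ℝ≥0 → Ω → ℝ}
    (h : IsSqIntegrableSubordinator T P) (hμ : 0 < ∫ ω, T 1 ω ∂P) {q : ℝ} (hq0 : 0 < q)
    (hq2 : q ≤ 2) (s : ℝ≥0) :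
    Tendsto (fun u : ℝ≥0 ↦ ((∫ ω, T (s + u) ω ^ q ∂P) + (∫ ω, T s ω ^ q ∂P) -
      ∫ ω, T u ω ^ q ∂P) / (u : ℝ) ^ (max (q - 1) 0)) atTop
      (𝓝 (incrementCoeff q s (∫ ω, T 1 ω ∂P) (∫ ω, T s ω ^ q ∂P))) := by
  unfold incrementCoeff
  split_ifs with h1 h2
  · rw [max_eq_right (by linarith)]
    have := (h.tendsto_moment_increment_of_lt_one hμ hq0 h1 s).add_const (∫ ω, T s ω ^ q ∂P)
    rw [zero_add] at this
    refine this.congr fun u ↦ ?_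
    rw [Real.rpow_zero, add_comm u s]
    ring
  -- At the critical order the constant `m(s)` and the increment both equal `s μ`, hence the factor
  -- `2`.
  · subst h2
    refine tendsto_const_nhds.congr fun u ↦ ?_
    simp only [sub_self, max_self, Real.rpow_zero, Real.rpow_one, div_one]
    rw [h.integral_eq (s + u), h.integral_eq s, h.integral_eq u]
    push_cast
    ring
  · have hq1 : 1 < q := lt_of_le_of_ne (not_lt.1 h1) (Ne.symm h2)
    rw [max_eq_left (by linarith)]
    have := (h.tendsto_moment_increment_of_one_lt hμ hq1 hq2 s).add
      (((tendsto_rpow_neg_atTop (y := q - 1) (by linarith)).comp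
        tendsto_nnreal_coe_atTop).const_mul (∫ ω, T s ω ^ q ∂P))
    rw [mul_zero, add_zero] at this
    refine this.congr fun u ↦ ?_
    simp only [Function.comp_apply]
    rw [Real.rpow_neg u.coe_nonneg, add_comm u s]
    ring

/-! ### The correlation asymptotics -/

/-- The leading coefficient of the covariance. -/
noncomputable def covCoeff (H₁ H₂ lam α a b s : ℝ) : ℝ :=
  mixedCoeff a b (max (2 * H₁ - 1) 0) (max (2 * H₂ - 1) 0)
    (incrementCoeff (2 * H₁) s (temperedStableMoment lam α 1 1)
      (temperedStableMoment lam α (2 * H₁) s) / 2)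
    (incrementCoeff (2 * H₂) s (temperedStableMoment lam α 1 1)
      (temperedStableMoment lam α (2 * H₂) s) / 2)

/-- The leading coefficient of the variance. -/
noncomputable def varCoeff (H₁ H₂ lam α a b : ℝ) : ℝ :=
  mixedCoeff a b (2 * H₁) (2 * H₂) (temperedStableMoment lam α 1 1 ^ (2 * H₁))
    (temperedStableMoment lam α 1 1 ^ (2 * H₂))

/-- The denominator in the leading coefficient of the correlation. -/
noncomputable def normCoeff (H₁ H₂ lam α a b s : ℝ) : ℝ :=
  √(varCoeff H₁ H₂ lam α a b) * √(a ^ 2 * temperedStableMoment lam α (2 * H₁) s +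
    b ^ 2 * temperedStableMoment lam α (2 * H₂) s)

lemma effectiveHurst_eq (b H₁ H₂ : ℝ) : effectiveHurst b H₁ H₂ = if b = 0 then H₁ else H₂ := by
  unfold effectiveHurst
  split_ifs <;> rfl

lemma tendsto_corr_div_rpow {Ω : Type*} [MeasurableSpace Ω] {P : Measure Ω}
    [IsProbabilityMeasure P] {H₁ H₂ lam α a b : ℝ} {B₁ B₂ : ℝ≥0 → Ω → ℝ} {S : ℝ≥0 → Ω → ℝ≥0}
    (hH₁ : 0 < H₁) (hH₁₂ : H₁ ≤ H₂) (hH₂ : H₂ < 1) (hlam : 0 < lam) (hα₀ : 0 < α) (hα₁ : α < 1)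
    (hab : ¬(a = 0 ∧ b = 0)) (h₁ : IsFractionalBrownianMotion H₁ B₁ P)
    (h₂ : IsFractionalBrownianMotion H₂ B₂ P)
    (hB : IndepFun (fun ω t ↦ B₁ t ω) (fun ω t ↦ B₂ t ω) P)
    (hS : IsTemperedStableSubordinator lam α S P)
    (hBS : IndepFun (fun ω ↦ ((fun t ↦ B₁ t ω), (fun t ↦ B₂ t ω))) (fun ω t ↦ S t ω) P)
    {s : ℝ≥0} (hs : 0 < s) :
    Tendsto (fun t : ℝ≥0 ↦ corr (timeChange (gmfbm a b B₁ B₂) S t)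
      (timeChange (gmfbm a b B₁ B₂) S s) P /
      (t : ℝ) ^ (-(min (effectiveHurst b H₁ H₂) (1 - effectiveHurst b H₁ H₂)))) atTop
      (𝓝 (covCoeff H₁ H₂ lam α a b s / normCoeff H₁ H₂ lam α a b s)) := by
  have hH₂0 : 0 < H₂ := hH₁.trans_le hH₁₂
  have hT := hS.isSqIntegrableSubordinator hlam hα₀ hα₁
  have hμ : ∫ ω, (S 1 ω : ℝ) ∂P = temperedStableMoment lam α 1 1 := by
    simpa using hS.integral_rpow one_pos 1
  have := hS.isProbabilityMeasure_law one_pos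
  rw [NNReal.coe_one] at this
  have hμpos : 0 < temperedStableMoment lam α 1 1 :=
    temperedStableMoment_pos hlam hα₀ hα₁ zero_le_one zero_le_one one_le_two
  have hμ' : 0 < ∫ ω, (S 1 ω : ℝ) ∂P := hμ ▸ hμpos
  have hV := tendsto_mixed_div_rpow a b (by linarith : 2 * H₁ ≤ 2 * H₂)
    (hT.tendsto_moment_div_rpow hμ' (q := 2 * H₁) (by linarith) (by linarith))
    (hT.tendsto_moment_div_rpow hμ' (q := 2 * H₂) (by linarith) (by linarith))
  have hD : ∀ H : ℝ, 0 < H → H < 1 →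
      Tendsto (fun t : ℝ≥0 ↦ (((∫ ω, (S (s + (t - s)) ω : ℝ) ^ (2 * H) ∂P) +
        (∫ ω, (S s ω : ℝ) ^ (2 * H) ∂P) - ∫ ω, (S (t - s) ω : ℝ) ^ (2 * H) ∂P) / 2) /
        (t : ℝ) ^ (max (2 * H - 1) 0)) atTop
      (𝓝 (incrementCoeff (2 * H) s (∫ ω, (S 1 ω : ℝ) ∂P)
        (∫ ω, (S s ω : ℝ) ^ (2 * H) ∂P) / 2)) := fun H h0 h1 ↦ by
    have := (tendsto_tsub_div_rpow s (hT.tendsto_incrementCoeff hμ' (q := 2 * H)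
      (by linarith) (by linarith) s)).div_const 2
    exact this.congr fun t ↦ div_right_comm _ _ _
  have hC := tendsto_mixed_div_rpow a b
    (max_le_max_right 0 (by linarith : 2 * H₁ - 1 ≤ 2 * H₂ - 1))
    (hD H₁ hH₁ (by linarith)) (hD H₂ hH₂0 hH₂)
  simp only [hμ, hS.integral_rpow hs] at hC hV
  have hvpos : 0 < varCoeff H₁ H₂ lam α a b :=
    mixedCoeff_pos hab (Real.rpow_pos_of_pos hμpos _) (Real.rpow_pos_of_pos hμpos _)
  have eV : (if b = 0 then 2 * H₁ else 2 * H₂) = 2 * effectiveHurst b H₁ H₂ := by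
    rw [effectiveHurst_eq]; split_ifs <;> rfl
  have eC : (if b = 0 then max (2 * H₁ - 1) 0 else max (2 * H₂ - 1) 0) =
      max (2 * effectiveHurst b H₁ H₂ - 1) 0 := by
    rw [effectiveHurst_eq]; split_ifs <;> rfl
  rw [eV] at hV
  rw [eC] at hC
  have key := tendsto_ratio_div_rpow (√(a ^ 2 * temperedStableMoment lam α (2 * H₁) s +
    b ^ 2 * temperedStableMoment lam α (2 * H₂) s)) hvpos hC hV
  -- Covariance exponent minus standard-deviation exponent.
  have e : max (2 * effectiveHurst b H₁ H₂ - 1) 0 - effectiveHurst b H₁ H₂ =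
      -(min (effectiveHurst b H₁ H₂) (1 - effectiveHurst b H₁ H₂)) := by
    generalize effectiveHurst b H₁ H₂ = x
    rw [← max_neg_neg, ← max_sub_sub_right, max_comm]
    congr 1 <;> ring
  rw [e] at key
  refine key.congr' ?_
  filter_upwards [eventually_ge_atTop s] with t ht
  have hst : s + (t - s) = t := add_tsub_cancel_of_le ht
  have hcov := covariance_timeChange_gmfbm (a := a) (b := b) hH₁ (by linarith) hH₂0 hH₂.le
    h₁ h₂ hB hS.measurable hT hBS s (t - s)
  have hvar := variance_timeChange_gmfbm (a := a) (b := b) hH₁ (by linarith) hH₂0 hH₂.le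
    h₁ h₂ hB hS.measurable hT hBS
  rw [hst] at hcov
  unfold corr
  rw [hcov, hvar t, hvar s, hst, hS.integral_rpow hs, hS.integral_rpow hs]
  congr 2
  ring

theorem theorem2p3 (H₁ H₂ lam α a b : ℝ)
    (hH₁ : 0 < H₁) (hH₁₂ : H₁ ≤ H₂) (hH₂ : H₂ < 1)
    (hlam : 0 < lam) (hα₀ : 0 < α) (hα₁ : α < 1)
    (hab : ¬ (a = 0 ∧ b = 0)) (hH : 2 * H₁ - H₂ < 1) :
    ∃ c c₅ c₆ : ℝ≥0 → ℝ, (∀ s : ℝ≥0, 0 < s → 0 < c s ∧ 0 ≤ c₅ s ∧ 0 < c₆ s) ∧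
      ∀ (Ω : Type*) [MeasurableSpace Ω] (P : Measure Ω) [IsProbabilityMeasure P]
        (B₁ B₂ : ℝ≥0 → Ω → ℝ) (S : ℝ≥0 → Ω → ℝ≥0),
        IsFractionalBrownianMotion H₁ B₁ P →
        IsFractionalBrownianMotion H₂ B₂ P →
        IndepFun (fun ω t ↦ B₁ t ω) (fun ω t ↦ B₂ t ω) P →
        IsTemperedStableSubordinator lam α S P →
        IndepFun (fun ω ↦ ((fun t ↦ B₁ t ω), (fun t ↦ B₂ t ω))) (fun ω t ↦ S t ω) P →
        IsLongRangeDependent (timeChange (gmfbm a b B₁ B₂) S) P ∧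
        (∀ s : ℝ≥0, 0 < s →
          (fun t : ℝ≥0 ↦ corr (timeChange (gmfbm a b B₁ B₂) S t)
            (timeChange (gmfbm a b B₁ B₂) S s) P) ~[atTop]
          (fun t : ℝ≥0 ↦ c s *
            (t : ℝ) ^ (-(min (effectiveHurst b H₁ H₂) (1 - effectiveHurst b H₁ H₂))))) ∧
        (b ≠ 0 → 1 / 2 ≤ H₂ → ∀ s : ℝ≥0, 0 < s →
          (fun t : ℝ≥0 ↦ corr (timeChange (gmfbm a b B₁ B₂) S t)
            (timeChange (gmfbm a b B₁ B₂) S s) P) ~[atTop]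
          (fun t : ℝ≥0 ↦ c₅ s * (t : ℝ) ^ (2 * H₁ - H₂ - 1) + c₆ s * (t : ℝ) ^ (H₂ - 1))) := by
  -- The constants are integrals against the tempered stable laws; they are positive because these
  -- laws are probability measures, which is part of what `IsTemperedStableSubordinator` provides.
  by_cases hprob : ∀ t : ℝ≥0, 0 < t → IsProbabilityMeasure (temperedStableLaw lam α t)
  swap
  · refine ⟨1, 1, 1, fun s _ ↦ by simp, ?_⟩
    intro Ω _ P _ B₁ B₂ S _ _ _ hS _
    exact absurd (fun t ht ↦ hS.isProbabilityMeasure_law ht) hprob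
  have hH₂0 : 0 < H₂ := hH₁.trans_le hH₁₂
  set μ := temperedStableMoment lam α 1 1 with hμdef
  have hμ : 0 < μ := by
    have := hprob 1 one_pos
    rw [NNReal.coe_one] at this
    exact temperedStableMoment_pos hlam hα₀ hα₁ zero_le_one zero_le_one one_le_two
  have hm : ∀ s : ℝ≥0, 0 < s → ∀ H, 0 < H → H < 1 → 0 < temperedStableMoment lam α (2 * H) s :=
    fun s hs H h0 h1 ↦ by
      have := hprob s hs
      exact temperedStableMoment_pos hlam hα₀ hα₁ s.coe_nonneg (by linarith) (by linarith)
  have hδ : ∀ s : ℝ≥0, 0 < s → ∀ H, 0 < H → H < 1 →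
      0 < incrementCoeff (2 * H) s μ (temperedStableMoment lam α (2 * H) s) :=
    fun s hs H h0 h1 ↦ incrementCoeff_pos hs hμ (hm s hs H h0 h1)
  have hcov : ∀ s : ℝ≥0, 0 < s → 0 < covCoeff H₁ H₂ lam α a b s := fun s hs ↦
    mixedCoeff_pos hab (half_pos (hδ s hs H₁ hH₁ (by linarith))) (half_pos (hδ s hs H₂ hH₂0 hH₂))
  have hnorm : ∀ s : ℝ≥0, 0 < s → 0 < normCoeff H₁ H₂ lam α a b s := fun s hs ↦ by
    refine mul_pos (Real.sqrt_pos.2 (mixedCoeff_pos hab (Real.rpow_pos_of_pos hμ _)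
      (Real.rpow_pos_of_pos hμ _))) (Real.sqrt_pos.2 ?_)
    have m₁ := hm s hs H₁ hH₁ (by linarith)
    have m₂ := hm s hs H₂ hH₂0 hH₂
    by_cases ha : a = 0
    · have hb : b ≠ 0 := fun hb ↦ hab ⟨ha, hb⟩
      positivity
    · positivity
  set c : ℝ≥0 → ℝ := fun s ↦ covCoeff H₁ H₂ lam α a b s / normCoeff H₁ H₂ lam α a b s with hc
  -- The first component's share of the covariance, `a²` times half of `q s μ ^ q` with `q = 2H₁`,
  -- divided by the normalisation. Its size matters only when `H₁ = H₂`; it is set to `0` where the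
  -- two-term form is not claimed, so that the other constant stays positive there.
  set c₅ : ℝ≥0 → ℝ := fun s ↦ if b ≠ 0 ∧ 1 / 2 ≤ H₂ then
    a ^ 2 * H₁ * s * μ ^ (2 * H₁) / normCoeff H₁ H₂ lam α a b s else 0 with hc₅
  have hcpos : ∀ s : ℝ≥0, 0 < s → 0 < c s := fun s hs ↦ div_pos (hcov s hs) (hnorm s hs)
  -- When `H₁ = H₂` both powers coincide and the two constants must add up to `c s`; otherwise the
  -- second must be `c s` itself.
  refine ⟨c, c₅, fun s ↦ c s - if H₁ = H₂ then c₅ s else 0, fun s hs ↦ ⟨hcpos s hs, ?_, ?_⟩, ?_⟩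
  · have := hnorm s hs
    simp only [hc₅]
    split_ifs <;> positivity
  · split_ifs with he
    · simp only [hc, hc₅]
      split_ifs with hb
      · rw [← sub_div]
        refine div_pos (sub_pos.2 ?_) (hnorm s hs)
        subst he
        unfold covCoeff mixedCoeff
        rw [if_neg hb.1, if_pos rfl, ← hμdef]
        have := mul_rpow_le_incrementCoeff (m := temperedStableMoment lam α (2 * H₁) s)
          (q := 2 * H₁) (s := s) hs hμ (by linarith [hb.2])
        have h2 := half_pos (hδ s hs H₁ hH₁ hH₂)
        have hb2 : 0 < b ^ 2 := by have := hb.1; positivity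
        have h3 := mul_pos hb2 h2
        have h4 := mul_le_mul_of_nonneg_left this (sq_nonneg a)
        linarith
      · rw [sub_zero]; exact hcpos s hs
    · simpa using hcpos s hs
  intro Ω _ P _ B₁ B₂ S h₁ h₂ hB hS hBS
  have main : ∀ s : ℝ≥0, 0 < s →
      (fun t : ℝ≥0 ↦ corr (timeChange (gmfbm a b B₁ B₂) S t)
        (timeChange (gmfbm a b B₁ B₂) S s) P) ~[atTop]
      (fun t : ℝ≥0 ↦ c s *
        (t : ℝ) ^ (-(min (effectiveHurst b H₁ H₂) (1 - effectiveHurst b H₁ H₂)))) := fun s hs ↦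
    isEquivalent_const_mul_rpow (hcpos s hs).ne'
      (tendsto_corr_div_rpow hH₁ hH₁₂ hH₂ hlam hα₀ hα₁ hab h₁ h₂ hB hS hBS hs)
  refine ⟨⟨memLp_timeChange_gmfbm hH₁ (by linarith) hH₂0 hH₂.le h₁ h₂ hB hS.measurable
    (hS.isSqIntegrableSubordinator hlam hα₀ hα₁) hBS, _, ?_, ?_, c,
    fun s hs ↦ ⟨(hcpos s hs).ne', main s hs⟩⟩, main, fun hb hH₂' s hs ↦ ?_⟩
  · rw [effectiveHurst_eq]
    split_ifs <;> exact lt_min (by linarith) (by linarith)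
  · rw [effectiveHurst_eq]
    split_ifs <;> exact (min_le_left _ _).trans_lt (by linarith)
  · have hmain := main s hs
    rw [effectiveHurst_eq, if_neg hb, min_eq_right (by linarith), neg_sub] at hmain
    -- The exponents `2H₁ - H₂ - 1` and `H₂ - 1` differ by `2 (H₂ - H₁)`, so the first power either
    -- merges with the second or is negligible.
    rcases hH₁₂.eq_or_lt with he | hlt
    · refine hmain.congr_right (.of_forall fun t ↦ ?_)
      dsimp only
      rw [if_pos he, he, show 2 * H₂ - H₂ - 1 = H₂ - 1 by ring]
      ring
    · simp only [if_neg hlt.ne, sub_zero]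
      exact hmain.trans (const_mul_rpow_add_isEquivalent (hcpos s hs).ne' (by linarith)).symm
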